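/- Let $M$ be a smooth (finite-dimensional, Hausdorff, second countable, boundaryless) manifold that is connected and simply connected, and let $G$ be a (real, finite-dimensional) Lie group with Lie algebra $\mathfrak g$. Let $\Omega^1(M,\mathfrak g)$ be the space of smooth $\mathfrak g$-valued one-forms on $M$, with $[\alpha,\beta](v,w)=[\alpha(v),\beta(w)]-[\alpha(w),\beta(v)]$ for $\alpha,\beta\in\Omega^1(M,\mathfrak g)$ and $[\alpha,F](v)=[\alpha(v),F(x)]$ for $F\in C^\infty(M,\mathfrak g)$, $v\in T_xM$. Let $$\mathcal A=\left\{\alpha\in\Omega^1(M,\mathfrak g) : d\alpha+\tfrac12[\alpha,\alpha]=0\right\},$$ and for $\alpha\in\mathcal A$ let $T_\alpha\mathcal A$ be the set of all $\dot\beta(0)$, where $\beta:(-\varepsilon,\varepsilon)\to\Omega^1(M,\mathfrak g)$, $\varepsilon>0$, is a smooth curve (that is, $(t,x)\mapsto\beta(t)|_x$ is smooth) with $\beta(0)=\alpha$ and $\beta(t)\in\mathcal A$ for every $t\in(-\varepsilon,\varepsilon)$. Then for every $\alpha\in\mathcal A$, $$T_\alpha\mathcal A=\left\{dF+[\alpha,F]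 : F\in C^\infty(M,\mathfrak g)\right\}.$$ -/

import Mathlib

open scoped Manifold ContDiff Bundle

noncomputable section

/-! ### The Lie algebra of a Lie group, as a normed space -/

section LieAlgebraOfGroup

/-- The Lie algebra `𝔤 = T_1 G` of a Lie group `G` modelled on the finite-dimensional space `EG`.
As a vector space it is the model space `EG` (from which it takes a norm, all norms being
equivalent); its bracket is Mathlib's bracket of left-invariant vector fields. -/
def LieAlg (EG : Type*) [NormedAddCommGroup EG] [NormedSpace ℝ EG]
    (G : Type*) [TopologicalSpace G] [ChartedSpace EG G] [Group G] : Type _ :=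
  GroupLieAlgebra 𝓘(ℝ, EG) G

variable (EG : Type*) [NormedAddCommGroup EG] [NormedSpace ℝ EG]
  (G : Type*) [TopologicalSpace G] [ChartedSpace EG G] [Group G]

instance LieAlg.instNormedAddCommGroup : NormedAddCommGroup (LieAlg EG G) :=
  inferInstanceAs (NormedAddCommGroup EG)

instance LieAlg.instNormedSpace : NormedSpace ℝ (LieAlg EG G) :=
  inferInstanceAs (NormedSpace ℝ EG)

instance LieAlg.instFiniteDimensional [FiniteDimensional ℝ EG] :
    FiniteDimensional ℝ (LieAlg EG G) :=
  inferInstanceAs (FiniteDimensional ℝ EG)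

instance LieAlg.instBracket : Bracket (LieAlg EG G) (LieAlg EG G) :=
  inferInstanceAs (Bracket (GroupLieAlgebra 𝓘(ℝ, EG) G) (GroupLieAlgebra 𝓘(ℝ, EG) G))

variable [LieGroup 𝓘(ℝ, EG) ∞ G]

theorem LieAlg.lieGroup_minSmoothness : LieGroup 𝓘(ℝ, EG) (minSmoothness ℝ 3) G := by
  have h : minSmoothness ℝ 3 ≤ (∞ : WithTop ℕ∞) := by
    rw [minSmoothness_of_isRCLikeNormedField]
    exact WithTop.coe_le_coe.2 (le_top : (3 : ℕ∞) ≤ ⊤)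
  exact LieGroup.of_le h

variable [FiniteDimensional ℝ EG]

/-- The bracket of `𝔤` as a continuous bilinear map. -/
def LieAlg.bracketL : LieAlg EG G →L[ℝ] LieAlg EG G →L[ℝ] LieAlg EG G :=
  haveI := LieAlg.lieGroup_minSmoothness EG G
  haveI : CompleteSpace EG := FiniteDimensional.complete ℝ EG
  LinearMap.toContinuousLinearMap
    ((LinearMap.toContinuousLinearMap :
        (LieAlg EG G →ₗ[ℝ] LieAlg EG G) ≃ₗ[ℝ] _).toLinearMap ∘ₗ
      LinearMap.mk₂ ℝ (fun v w : LieAlg EG G => ⁅v, w⁆)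
        (fun v v' w => add_lie (L := GroupLieAlgebra 𝓘(ℝ, EG) G)
          (M := GroupLieAlgebra 𝓘(ℝ, EG) G) v v' w)
        (fun c v w => smul_lie (L := GroupLieAlgebra 𝓘(ℝ, EG) G)
          (M := GroupLieAlgebra 𝓘(ℝ, EG) G) c v w)
        (fun v w w' => lie_add (L := GroupLieAlgebra 𝓘(ℝ, EG) G)
          (M := GroupLieAlgebra 𝓘(ℝ, EG) G) v w w')
        (fun c v w => lie_smul (L := GroupLieAlgebra 𝓘(ℝ, EG) G)
          (M := GroupLieAlgebra 𝓘(ℝ, EG) G) c v w))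

@[simp]
theorem LieAlg.bracketL_apply (v w : LieAlg EG G) : LieAlg.bracketL EG G v w = ⁅v, w⁆ := rfl

end LieAlgebraOfGroup

/-! ### Vector-valued one-forms and functions on a manifold -/

section Forms

variable {E : Type*} [NormedAddCommGroup E] [NormedSpace ℝ E]
  {M : Type*} [TopologicalSpace M] [ChartedSpace E M] [IsManifold 𝓘(ℝ, E) ∞ M]
  {V : Type*} [NormedAddCommGroup V] [NormedSpace ℝ V]

/-- `Ω¹(M, V)`: smooth sections of the vector bundle `Hom(TM, V) = T*M ⊗ V`. -/
abbrev OneForm (E : Type*) [NormedAddCommGroup E] [NormedSpace ℝ E]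
    (M : Type*) [TopologicalSpace M] [ChartedSpace E M] [IsManifold 𝓘(ℝ, E) ∞ M]
    (V : Type*) [NormedAddCommGroup V] [NormedSpace ℝ V] :=
  ContMDiffSection 𝓘(ℝ, E) (E →L[ℝ] V) ∞
    (fun x : M => TangentSpace 𝓘(ℝ, E) x →L[ℝ] Bundle.Trivial M V x)

/-- The exterior derivative `dF` of a smooth function `F : M → V`. -/
def extDerivZero (F : C^∞⟮𝓘(ℝ, E), M; 𝓘(ℝ, V), V⟯) : OneForm E M V where
  toFun x := mfderiv 𝓘(ℝ, E) 𝓘(ℝ, V) F x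
  contMDiff_toFun := by
    intro x₀
    rw [contMDiffAt_hom_bundle]
    refine ⟨contMDiffAt_id, ?_⟩
    have h := (F.contMDiff x₀).mfderiv_const (m := ∞) (by simp)
    refine h.congr_of_eventuallyEq (Filter.Eventually.of_forall fun x => ?_)
    ext v
    simp [ContinuousLinearMap.inCoordinates, inTangentCoordinates]
    rfl

/-- The coordinate expression of the one-form `α` in the preferred chart `φ` at `x`, that is the
pullback of `α` by `φ⁻¹`, as a `V`-valued one-form on the model space (meaningful on the image of
the chart). -/
def OneForm.inChart (α : OneForm E M V) (x : M) (y : E) : E [⋀^Fin 1]→L[ℝ] V :=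
  ContinuousAlternatingMap.ofSubsingleton ℝ E V (0 : Fin 1)
    ((α ((extChartAt 𝓘(ℝ, E) x).symm y)).comp
      (mfderiv 𝓘(ℝ, E) 𝓘(ℝ, E) (extChartAt 𝓘(ℝ, E) x).symm y))

/-- The exterior derivative `dα` of a one-form, at the point `x`: the exterior derivative of the
coordinate expression of `α` at the image of `x`, pulled back to `T_x M` by the chart.
Normalization: `dα(X, Y) = X(α(Y)) - Y(α(X)) - α([X, Y])`. -/
def OneForm.extDeriv (α : OneForm E M V) (x : M) : TangentSpace 𝓘(ℝ, E) x [⋀^Fin 2]→L[ℝ] V :=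
  (_root_.extDeriv (α.inChart x) (extChartAt 𝓘(ℝ, E) x x)).compContinuousLinearMap
    (mfderiv 𝓘(ℝ, E) 𝓘(ℝ, E) (extChartAt 𝓘(ℝ, E) x) x)

end Forms

/-! ### Lie-algebra-valued forms -/

section LieForms

variable {E : Type*} [NormedAddCommGroup E] [NormedSpace ℝ E]
  {M : Type*} [TopologicalSpace M] [ChartedSpace E M] [IsManifold 𝓘(ℝ, E) ∞ M]
  {EG : Type*} [NormedAddCommGroup EG] [NormedSpace ℝ EG]
  {G : Type*} [TopologicalSpace G] [ChartedSpace EG G] [Group G]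

/-- The two-form `[α, β](v, w) = [α(v), β(w)] - [α(w), β(v)]`. -/
def OneForm.bracket (α β : OneForm E M (LieAlg EG G)) (x : M)
    (v w : TangentSpace 𝓘(ℝ, E) x) : LieAlg EG G :=
  ⁅(α x v : LieAlg EG G), (β x w : LieAlg EG G)⁆ - ⁅(α x w : LieAlg EG G), (β x v : LieAlg EG G)⁆

/-- The one-form `[α, F](v) = [α(v), F(x)]`, `v ∈ T_x M`, for a function `F : M → 𝔤`. -/
def OneForm.bracketZero [FiniteDimensional ℝ EG] [LieGroup 𝓘(ℝ, EG) ∞ G]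
    (α : OneForm E M (LieAlg EG G)) (F : C^∞⟮𝓘(ℝ, E), M; 𝓘(ℝ, LieAlg EG G), LieAlg EG G⟯) :
    OneForm E M (LieAlg EG G) where
  toFun x := ((LieAlg.bracketL EG G).flip (F x)).comp (α x)
  contMDiff_toFun := by
    intro x₀
    have hα := (contMDiffAt_hom_bundle _).1 (α.contMDiff x₀)
    rw [contMDiffAt_hom_bundle]
    refine ⟨contMDiffAt_id, ?_⟩
    have hB : ContMDiffAt 𝓘(ℝ, E) 𝓘(ℝ, LieAlg EG G →L[ℝ] LieAlg EG G) ∞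
        (fun x => (LieAlg.bracketL EG G).flip (F x)) x₀ :=
      (LieAlg.bracketL EG G).flip.contMDiff.contMDiffAt.comp x₀ (F.contMDiff x₀)
    refine (hB.clm_comp hα.2).congr_of_eventuallyEq (Filter.Eventually.of_forall fun x => ?_)
    ext v
    simp [ContinuousLinearMap.inCoordinates]

/-- The space `𝒜` of `𝔤`-valued one-forms satisfying `dα + ½[α, α] = 0`. -/
def maurerCartanForms (E M EG G : Type*) [NormedAddCommGroup E] [NormedSpace ℝ E]
    [TopologicalSpace M] [ChartedSpace E M] [IsManifold 𝓘(ℝ, E) ∞ M]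
    [NormedAddCommGroup EG] [NormedSpace ℝ EG]
    [TopologicalSpace G] [ChartedSpace EG G] [Group G] : Set (OneForm E M (LieAlg EG G)) :=
  {α | ∀ (x : M) (v w : TangentSpace 𝓘(ℝ, E) x),
    α.extDeriv x ![v, w] + (1 / 2 : ℝ) • α.bracket α x v w = 0}

/-- The curve `β` of one-forms is smooth on the set `s` of parameters: `(t, x) ↦ β(t)|_x` is a
smooth map from `s × M` to the bundle `Hom(TM, V)`. -/
def SmoothCurveOn {V : Type*} [NormedAddCommGroup V] [NormedSpace ℝ V]
    (β : ℝ → OneForm E M V) (s : Set ℝ) : Prop :=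
  ContMDiffOn (𝓘(ℝ, ℝ).prod 𝓘(ℝ, E)) (𝓘(ℝ, E).prod 𝓘(ℝ, E →L[ℝ] V)) ∞
    (fun p : ℝ × M => Bundle.TotalSpace.mk' (E →L[ℝ] V)
      (E := fun x : M => TangentSpace 𝓘(ℝ, E) x →L[ℝ] Bundle.Trivial M V x) p.2 (β p.1 p.2))
    (s ×ˢ Set.univ)

/-- `η` is the velocity of the curve `β` of one-forms at time `t`. -/
def HasVelocityAt {V : Type*} [NormedAddCommGroup V] [NormedSpace ℝ V]
    (β : ℝ → OneForm E M V) (η : OneForm E M V) (t : ℝ) : Prop :=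
  ∀ (x : M) (v : TangentSpace 𝓘(ℝ, E) x),
    HasDerivAt (fun s : ℝ => (β s x v : V)) (η x v : V) t

/-- The tangent space `T_α 𝒜`: all velocities `β'(0)` of smooth curves
`β : (-ε, ε) → Ω¹(M, 𝔤)` with `β(0) = α` and `β(t) ∈ 𝒜` for all `t ∈ (-ε, ε)`. -/
def tangentMaurerCartan (α : OneForm E M (LieAlg EG G)) : Set (OneForm E M (LieAlg EG G)) :=
  {η | ∃ (ε : ℝ) (β : ℝ → OneForm E M (LieAlg EG G)), 0 < ε ∧
    SmoothCurveOn β (Set.Ioo (-ε) ε) ∧ β 0 = α ∧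
    (∀ t ∈ Set.Ioo (-ε) ε, β t ∈ maurerCartanForms E M EG G) ∧ HasVelocityAt β η 0}

end LieForms

end

/-! The equation `dα + ½[α, α] = 0` says that `d + [α, ·]` is a flat connection on the trivial
bundle with fibre `𝔤`. Differentiating it along a curve in `𝒜` gives `dη + [α, η] = 0` for the
velocity `η`.

Velocities are covariant derivatives. The overdetermined linear system `dF = η - [α, F]` has as
integrability conditions exactly the flatness of `α` and the closedness of `η`. In a chart,
`IsFlatOn.exists_hasFDerivAt` solves it by Picard iteration with the radial homotopy operator: `d`
of the right-hand side is controlled by the defect of the current iterate, so by the homotopy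
formula the defects decay geometrically together with the increments. A solution is determined near
a point by its value there (a linear ODE along segments), so germs of solutions form a covering of
`M` with discrete fibre `𝔤`. Simple connectedness yields a global section, by
`exists_global_section_of_unique_continuation`.

Covariant derivatives are velocities. Given `F`, the gauge orbit of `α` under `exp (tF)` solves `β'
= dF + [β, F]`, `β(0) = α`. At each point of `M` this is a linear ODE in `t`, solved by an
exponential of endomorphisms of `𝔤 × 𝔤`, so no `G`-valued map is needed. The curvature `κ` of `β(t)`
satisfies `κ' = [κ, F]` and starts at zero, hence vanishes: this is
`gaugeCurve_mem_maurerCartanForms`. -/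

noncomputable section

/-! ### The radial homotopy operator on one-forms -/

section RadialPrimitive

open MeasureTheory Set Filter Topology

variable {E : Type*} [NormedAddCommGroup E] [NormedSpace ℝ E]
  {V : Type*} [NormedAddCommGroup V] [NormedSpace ℝ V]

/-- Differentiation under the integral sign for `C¹` integrands on a compact interval. -/
theorem hasFDerivAt_intervalIntegral_of_continuous [FiniteDimensional ℝ E]
    {g : E → ℝ → V} {g' : E → ℝ → E →L[ℝ] V}
    (hg : Continuous (Function.uncurry g)) (hg' : Continuous (Function.uncurry g'))
    (h : ∀ y t, HasFDerivAt (g · t) (g' y t) y) (a b : ℝ) (y : E) :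
    HasFDerivAt (fun y => ∫ t in a..b, g y t) (∫ t in a..b, g' y t) y := by
  have hK : IsCompact (Metric.closedBall y 1 ×ˢ uIcc a b) :=
    (isCompact_closedBall y 1).prod isCompact_uIcc
  obtain ⟨C, hC⟩ := hK.exists_bound_of_continuousOn hg'.continuousOn
  have hgc : ∀ z, Continuous (g z) := fun z => hg.comp (Continuous.prodMk_right z)
  have hgc' : ∀ z, Continuous (g' z) := fun z => hg'.comp (Continuous.prodMk_right z)
  refine intervalIntegral.hasFDerivAt_integral_of_dominated_of_fderiv_le (bound := fun _ => C)
    (Metric.closedBall_mem_nhds y one_pos) (.of_forall fun z => (hgc z).aestronglyMeasurable)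
    ((hgc y).intervalIntegrable _ _) (hgc' y).aestronglyMeasurable
    (.of_forall fun t ht z hz => hC (z, t) ⟨hz, uIoc_subset_uIcc ht⟩) (by simp)
    (.of_forall fun t _ z _ => h z t)

/-- The radial homotopy operator based at `p` on one-forms. -/
def radialPrimitive (θ : E → E →L[ℝ] V) (p y : E) : V :=
  ∫ t in (0 : ℝ)..1, θ (p + t • (y - p)) (y - p)

@[simp]
theorem radialPrimitive_self (θ : E → E →L[ℝ] V) (p : E) : radialPrimitive θ p p = 0 := by
  simp [radialPrimitive]

theorem continuous_flip_fderiv {θ : E → E →L[ℝ] V} (hθ : ContDiff ℝ 1 θ) :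
    Continuous fun y => (fderiv ℝ θ y).flip :=
  (ContinuousLinearMap.flipₗᵢ ℝ E E V).continuous.comp (hθ.continuous_fderiv one_ne_zero)

theorem hasFDerivAt_radialPrimitive [FiniteDimensional ℝ E] {θ : E → E →L[ℝ] V}
    (hθ : ContDiff ℝ 1 θ) (p y : E) :
    HasFDerivAt (radialPrimitive θ p)
      (∫ t in (0 : ℝ)..1, (θ (p + t • (y - p)) +
        t • (fderiv ℝ θ (p + t • (y - p))).flip (y - p))) y := by
  have hθ0 := hθ.continuous
  have hθ1 := continuous_flip_fderiv hθ
  refine hasFDerivAt_intervalIntegral_of_continuous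
    (g := fun y t => θ (p + t • (y - p)) (y - p))
    (g' := fun y t => θ (p + t • (y - p)) + t • (fderiv ℝ θ (p + t • (y - p))).flip (y - p))
    ?_ ?_ (fun y t => ?_) 0 1 y
  · simp only [Function.uncurry_def]; fun_prop
  · simp only [Function.uncurry_def]
    have : Continuous fun x : E × ℝ => (fderiv ℝ θ (p + x.2 • (x.1 - p))).flip :=
      hθ1.comp (by fun_prop)
    fun_prop
  · have h1 : HasFDerivAt (fun y : E => p + t • (y - p)) (t • ContinuousLinearMap.id ℝ E) y :=
      (((hasFDerivAt_id y).sub_const p).const_smul t).const_add p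
    have h2 := ((hθ.differentiable one_ne_zero _).hasFDerivAt.comp y h1).clm_apply
      ((hasFDerivAt_id y).sub_const p)
    refine h2.congr_fderiv ?_
    ext w
    simp

/-- The operator loses no regularity, so the Picard iterates below all stay `C¹`. -/
theorem contDiff_radialPrimitive [FiniteDimensional ℝ E] {θ : E → E →L[ℝ] V}
    (hθ : ContDiff ℝ 1 θ) (p : E) : ContDiff ℝ 1 (radialPrimitive θ p) := by
  rw [contDiff_one_iff_hasFDerivAt]
  refine ⟨_, ?_, hasFDerivAt_radialPrimitive hθ p⟩
  have hθ0 := hθ.continuous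
  have hθ1 := continuous_flip_fderiv hθ
  refine intervalIntegral.continuous_parametric_intervalIntegral_of_continuous' ?_ _ _
  simp only [Function.uncurry_def]
  have : Continuous fun x : E × ℝ => (fderiv ℝ θ (p + x.2 • (x.1 - p))).flip :=
    hθ1.comp (by fun_prop)
  fun_prop

/-- The homotopy formula, as an estimate: the radial primitive of a one-form `θ` fails to be a
primitive of `θ` by an amount controlled by `dθ`. -/
theorem norm_fderiv_radialPrimitive_sub_le [FiniteDimensional ℝ E] [CompleteSpace V]
    {θ : E → E →L[ℝ] V}
    (hθ : ContDiff ℝ 1 θ) {S : Set E} (hS : Convex ℝ S) {C : ℝ} (hC0 : 0 ≤ C)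
    (hC : ∀ z ∈ S, ∀ u w, ‖fderiv ℝ θ z u w - fderiv ℝ θ z w u‖ ≤ C * ‖u‖ * ‖w‖)
    {p y : E} (hp : p ∈ S) (hy : y ∈ S) :
    ‖fderiv ℝ (radialPrimitive θ p) y - θ y‖ ≤ C * ‖y - p‖ := by
  have hθ0 := hθ.continuous
  have hθ1 := hθ.continuous_fderiv one_ne_zero
  have hc : Continuous fun t : ℝ => (fderiv ℝ θ (p + t • (y - p))).flip :=
    (continuous_flip_fderiv hθ).comp (by fun_prop)
  rw [(hasFDerivAt_radialPrimitive hθ p y).fderiv]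
  refine ContinuousLinearMap.opNorm_le_bound _ (by positivity) fun w => ?_
  -- The integrand is the `t`-derivative of `t • θ (p + t • (y - p)) w`, which writes `θ y w` as an
  -- integral over the same segment.
  have hftc : ∫ t in (0 : ℝ)..1, (θ (p + t • (y - p)) w +
      t • fderiv ℝ θ (p + t • (y - p)) (y - p) w) = θ y w := by
    have hd : ∀ t : ℝ, HasDerivAt (fun t : ℝ => t • θ (p + t • (y - p)) w)
        (θ (p + t • (y - p)) w + t • fderiv ℝ θ (p + t • (y - p)) (y - p) w) t := by
      intro t
      have h1 : HasDerivAt (fun t : ℝ => p + t • (y - p)) (y - p) t := by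
        simpa using ((hasDerivAt_id t).smul_const (y - p)).const_add p
      have h2 := ((hθ.differentiable one_ne_zero _).hasFDerivAt.comp_hasDerivAt t h1)
      have h3 := h2.clm_apply (hasDerivAt_const t w)
      have h4 := (hasDerivAt_id t).smul h3
      refine h4.congr_deriv ?_
      simp [add_comm]
    rw [intervalIntegral.integral_eq_sub_of_hasDerivAt (fun t _ => hd t)]
    · simp
    · exact Continuous.intervalIntegrable (by fun_prop) _ _
  rw [sub_apply, ← hftc, ContinuousLinearMap.intervalIntegral_apply
    (Continuous.intervalIntegrable (by fun_prop) _ _), ← intervalIntegral.integral_sub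
    (Continuous.intervalIntegrable (by fun_prop) _ _)
    (Continuous.intervalIntegrable (by fun_prop) _ _)]
  have := intervalIntegral.norm_integral_le_of_norm_le_const (a := (0 : ℝ)) (b := 1)
    (C := C * ‖y - p‖ * ‖w‖) (f := fun t => (θ (p + t • (y - p)) +
        t • (fderiv ℝ θ (p + t • (y - p))).flip (y - p)) w - (θ (p + t • (y - p)) w +
      t • fderiv ℝ θ (p + t • (y - p)) (y - p) w)) ?_
  · simpa using this
  · intro t ht
    rw [uIoc_of_le zero_le_one] at ht
    have hz : p + t • (y - p) ∈ S := hS.add_smul_sub_mem hp hy ⟨ht.1.le, ht.2⟩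
    have h1 := hC _ hz (y - p) w
    -- The two integrands differ exactly by `-t • dθ (y - p, w)`.
    have : (θ (p + t • (y - p)) + t • (fderiv ℝ θ (p + t • (y - p))).flip (y - p)) w -
        (θ (p + t • (y - p)) w + t • fderiv ℝ θ (p + t • (y - p)) (y - p) w) =
        -(t • (fderiv ℝ θ (p + t • (y - p)) (y - p) w - fderiv ℝ θ (p + t • (y - p)) w (y - p))) := by
      simp [smul_sub]
    rw [this, norm_neg, norm_smul, Real.norm_of_nonneg ht.1.le]
    calc _ ≤ 1 * _ := mul_le_mul_of_nonneg_right ht.2 (norm_nonneg _)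
      _ ≤ _ := by rw [one_mul]; exact h1

end RadialPrimitive

/-! ### Flat affine systems on convex sets: existence and uniqueness -/

section FlatSystem

open Set Filter Topology

variable {E : Type*} [NormedAddCommGroup E] [NormedSpace ℝ E]
  {V : Type*} [NormedAddCommGroup V] [NormedSpace ℝ V]

/-- The right-hand side `b - [a, F]` of the total differential system `dF + [a, F] = b`, where
`B = [·, ·]`. -/
def affineForm (B : V →L[ℝ] V →L[ℝ] V) (a b : E → E →L[ℝ] V) (F : E → V) (y : E) : E →L[ℝ] V :=
  b y - (B.flip (F y)).comp (a y)

variable {B : V →L[ℝ] V →L[ℝ] V} {a b : E → E →L[ℝ] V} {F : E → V}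

@[simp]
theorem affineForm_apply (B : V →L[ℝ] V →L[ℝ] V) (a b : E → E →L[ℝ] V) (F : E → V) (y u : E) :
    affineForm B a b F y u = b y u - B (a y u) (F y) := by
  simp [affineForm]

/-- The integrability condition on a set for the system `dF + [a, F] = b`: the connection `a` is
flat and `b` is closed for the associated covariant derivative. -/
structure IsFlatOn (B : V →L[ℝ] V →L[ℝ] V) (a b : E → E →L[ℝ] V) (S : Set E) : Prop where
  curvature : ∀ y ∈ S, ∀ u w, fderiv ℝ a y u w - fderiv ℝ a y w u + B (a y u) (a y w) = 0
  closed : ∀ y ∈ S, ∀ u w, fderiv ℝ b y u w - fderiv ℝ b y w u +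
    (B (a y u) (b y w) - B (a y w) (b y u)) = 0

theorem contDiff_affineForm {n : ℕ∞} (ha : ContDiff ℝ n a) (hb : ContDiff ℝ n b)
    (hF : ContDiff ℝ n F) : ContDiff ℝ n (affineForm B a b F) :=
  hb.sub ((B.flip.contDiff.comp hF).clm_comp ha)

theorem norm_affineForm_sub_le {S : Set E} {K κ : ℝ} (hK : ∀ u v, ‖B u v‖ ≤ K * ‖u‖ * ‖v‖)
    (hK0 : 0 ≤ K) (hκ : ∀ y ∈ S, ‖a y‖ ≤ κ) (F G : E → V) {y : E}
    (hy : y ∈ S) : ‖affineForm B a b F y - affineForm B a b G y‖ ≤ K * κ * ‖F y - G y‖ := by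
  have hκ0 := (norm_nonneg _).trans (hκ y hy)
  refine ContinuousLinearMap.opNorm_le_bound _ (by positivity) fun u => ?_
  have : (affineForm B a b F y - affineForm B a b G y) u = B (a y u) (G y - F y) := by
    simp
  rw [this, norm_sub_rev (F y)]
  refine (hK _ _).trans ?_
  calc _ ≤ K * (κ * ‖u‖) * ‖G y - F y‖ := by
        gcongr
        exact ((a y).le_opNorm u).trans (mul_le_mul_of_nonneg_right (hκ y hy) (norm_nonneg _))
    _ = _ := by ring

theorem fderiv_affineForm_apply {y : E} (ha : DifferentiableAt ℝ a y) (hb : DifferentiableAt ℝ b y)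
    (hF : DifferentiableAt ℝ F y) (u w : E) :
    fderiv ℝ (affineForm B a b F) y u w =
      fderiv ℝ b y u w - B (fderiv ℝ a y u w) (F y) - B (a y w) (fderiv ℝ F y u) := by
  have h1 := (B.flip.hasFDerivAt (x := F y)).comp y hF.hasFDerivAt
  have h3 : HasFDerivAt (affineForm B a b F) _ y :=
    hb.hasFDerivAt.sub (h1.clm_comp ha.hasFDerivAt)
  rw [h3.fderiv]
  simp
  abel

/-- The exterior derivative of `b - [a, F]` is controlled by the failure of `F` to solve the
system. -/
theorem IsFlatOn.norm_extDeriv_affineForm_le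
    (hJ : ∀ u v w, B u (B v w) - B v (B u w) = B (B u v) w)
    {S : Set E} (h : IsFlatOn B a b S) {K κ ε : ℝ} (hK : ∀ u v, ‖B u v‖ ≤ K * ‖u‖ * ‖v‖)
    (hK0 : 0 ≤ K) {y : E} (hy : y ∈ S) (hκ : ‖a y‖ ≤ κ) (ha : DifferentiableAt ℝ a y)
    (hb : DifferentiableAt ℝ b y) (hF : DifferentiableAt ℝ F y)
    (hε : ‖fderiv ℝ F y - affineForm B a b F y‖ ≤ ε) (u w : E) :
    ‖fderiv ℝ (affineForm B a b F) y u w - fderiv ℝ (affineForm B a b F) y w u‖ ≤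
      2 * (K * κ) * ε * ‖u‖ * ‖w‖ := by
  rw [fderiv_affineForm_apply ha hb hF, fderiv_affineForm_apply ha hb hF]
  -- Flatness, bracketed with `F y`; the Jacobi identity turns `[[a u, a w], F]` into the iterated
  -- brackets that arise from substituting the system into itself.
  have h1 := congr_arg (fun z => B z (F y)) (h.curvature y hy u w)
  simp only [map_add, map_sub, add_apply, sub_apply, map_zero, zero_apply, ← hJ] at h1
  have h2 := h.closed y hy u w
  set D := fderiv ℝ F y - affineForm B a b F y with hD
  have hDu : ∀ u, fderiv ℝ F y u = D u + (b y u - B (a y u) (F y)) := by intro u; simp [hD]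
  -- Replacing `dF` by right-hand side plus defect `D`, the terms in `F` cancel by flatness and
  -- those in `b` by closedness. Only terms in `D` survive.
  have key : fderiv ℝ b y u w - B (fderiv ℝ a y u w) (F y) - B (a y w) (fderiv ℝ F y u) -
      (fderiv ℝ b y w u - B (fderiv ℝ a y w u) (F y) - B (a y u) (fderiv ℝ F y w)) =
      B (a y u) (D w) - B (a y w) (D u) := by
    rw [hDu, hDu]
    simp only [map_add, map_sub]
    linear_combination (norm := module) h2 - h1
  have hb' : ∀ u w, ‖B (a y u) (D w)‖ ≤ (K * κ) * ε * ‖u‖ * ‖w‖ := by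
    intro u w
    have hκ0 := (norm_nonneg _).trans hκ
    calc ‖B (a y u) (D w)‖ ≤ K * ‖a y u‖ * ‖D w‖ := hK _ _
      _ ≤ K * (κ * ‖u‖) * (ε * ‖w‖) := by
        gcongr
        · exact ((a y).le_opNorm u).trans (mul_le_mul_of_nonneg_right hκ (norm_nonneg _))
        · exact (D.le_opNorm w).trans (mul_le_mul_of_nonneg_right hε (norm_nonneg _))
      _ = _ := by ring
  rw [key]
  calc _ ≤ (K * κ) * ε * ‖u‖ * ‖w‖ + (K * κ) * ε * ‖w‖ * ‖u‖ :=
        (norm_sub_le _ _).trans (add_le_add (hb' u w) (hb' w u))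
    _ = _ := by ring

theorem norm_radialPrimitive_sub_le {θ θ' : E → E →L[ℝ] V} (hθ : Continuous θ)
    (hθ' : Continuous θ') {S : Set E}
    (hS : Convex ℝ S) {C : ℝ} (hC : ∀ y ∈ S, ‖θ y - θ' y‖ ≤ C) {p y : E} (hp : p ∈ S)
    (hy : y ∈ S) : ‖radialPrimitive θ p y - radialPrimitive θ' p y‖ ≤ C * ‖y - p‖ := by
  rw [radialPrimitive, radialPrimitive, ← intervalIntegral.integral_sub
    (Continuous.intervalIntegrable (by fun_prop) _ _)
    (Continuous.intervalIntegrable (by fun_prop) _ _)]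
  have := intervalIntegral.norm_integral_le_of_norm_le_const (a := (0 : ℝ)) (b := 1)
    (C := C * ‖y - p‖)
    (f := fun t => θ (p + t • (y - p)) (y - p) - θ' (p + t • (y - p)) (y - p)) fun t ht => ?_
  · simpa using this
  · rw [uIoc_of_le zero_le_one] at ht
    rw [← sub_apply]
    exact (ContinuousLinearMap.le_opNorm _ _).trans
      (mul_le_mul_of_nonneg_right (hC _ (hS.add_smul_sub_mem hp hy ⟨ht.1.le, ht.2⟩))
        (norm_nonneg _))

/-- Picard iterates for the system `dF + [a, F] = b`. -/
def flatIterate (B : V →L[ℝ] V →L[ℝ] V) (a b : E → E →L[ℝ] V) (p : E) (c : V) : ℕ → E → V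
  | 0 => fun _ => c
  | n + 1 => fun y => c + radialPrimitive (affineForm B a b (flatIterate B a b p c n)) p y

theorem flatIterate_self (B : V →L[ℝ] V →L[ℝ] V) (a b : E → E →L[ℝ] V) (p : E) (c : V) (n : ℕ) :
    flatIterate B a b p c n p = c := by
  cases n <;> simp [flatIterate]

theorem contDiff_flatIterate [FiniteDimensional ℝ E] (ha : ContDiff ℝ 1 a) (hb : ContDiff ℝ 1 b)
    (p : E) (c : V) (n : ℕ) : ContDiff ℝ 1 (flatIterate B a b p c n) := by
  induction n with
  | zero => exact contDiff_const
  | succ n ih =>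
    exact contDiff_const.add (contDiff_radialPrimitive (contDiff_affineForm ha hb ih) p)

/-- A flat affine system `dF + [a, F] = b` is solvable on a small convex open set, with prescribed
value at any given point. -/
theorem IsFlatOn.exists_hasFDerivAt [FiniteDimensional ℝ E] [CompleteSpace V] {S : Set E}
    (hJ : ∀ u v w, B u (B v w) - B v (B u w) = B (B u v) w)
    (h : IsFlatOn B a b S) (ha : ContDiff ℝ 1 a) (hb : ContDiff ℝ 1 b) (hS : Convex ℝ S)
    (hSo : IsOpen S) {K κ β ρ : ℝ} (hK : ∀ u v, ‖B u v‖ ≤ K * ‖u‖ * ‖v‖)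
    (hK0 : 0 ≤ K) (hκ : ∀ y ∈ S, ‖a y‖ ≤ κ) (hβ : ∀ y ∈ S, ‖b y‖ ≤ β)
    (hρ : ∀ y ∈ S, ∀ z ∈ S, ‖y - z‖ ≤ ρ) (hκρ : K * κ * ρ ≤ 1 / 8) {p : E} (hp : p ∈ S) (c : V) :
    ∃ F : E → V, F p = c ∧ ∀ y ∈ S, HasFDerivAt F (affineForm B a b F y) y := by
  have hκ0 : 0 ≤ κ := (norm_nonneg _).trans (hκ p hp)
  have hKκ : 0 ≤ K * κ := mul_nonneg hK0 hκ0
  have hβ0 : 0 ≤ β := (norm_nonneg _).trans (hβ p hp)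
  have hρ0 : 0 ≤ ρ := (norm_nonneg _).trans (hρ p hp p hp)
  set f := flatIterate B a b p c with hf
  have hfC : ∀ n, ContDiff ℝ 1 (f n) := contDiff_flatIterate ha hb p c
  have hfd : ∀ n y, DifferentiableAt ℝ (f n) y := fun n => (hfC n).differentiable one_ne_zero
  have hθC : ∀ n, ContDiff ℝ 1 (affineForm B a b (f n)) := fun n =>
    contDiff_affineForm ha hb (hfC n)
  -- A bound for `b - [a, c]`, the right-hand side at the constant initial iterate.
  set M := β + K * κ * ‖c‖ with hM
  have hM0 : 0 ≤ M := by positivity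
  have hθ0 : ∀ y ∈ S, ‖affineForm B a b (f 0) y‖ ≤ M := by
    intro y hy
    refine (norm_sub_le _ _).trans (add_le_add (hβ y hy) ?_)
    refine ContinuousLinearMap.opNorm_le_bound _ (by positivity) fun u => (hK _ _).trans ?_
    calc _ ≤ K * (κ * ‖u‖) * ‖c‖ := by
          gcongr
          · exact ((a y).le_opNorm u).trans (mul_le_mul_of_nonneg_right (hκ y hy) (norm_nonneg _))
          · exact le_rfl
      _ = _ := by ring
  -- Increments contract by the factor `K * κ * ρ ≤ 1 / 8`; the weaker ratio `1 / 4` suffices.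
  have hδ : ∀ n, ∀ y ∈ S, ‖f (n + 1) y - f n y‖ ≤ M * ρ * (1 / 4) ^ n := by
    intro n
    induction n with
    | zero =>
      intro y hy
      have := norm_radialPrimitive_sub_le (hθC 0).continuous
        (continuous_const (y := (0 : E →L[ℝ] V))) hS (C := M) (by simpa using hθ0) hp hy
      have h0 : radialPrimitive (fun _ : E => (0 : E →L[ℝ] V)) p y = 0 := by simp [radialPrimitive]
      rw [h0, sub_zero] at this
      have h1 : f (0 + 1) y - f 0 y = radialPrimitive (affineForm B a b (f 0)) p y := by
        simp [hf, flatIterate]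
      rw [h1]
      refine this.trans ?_
      have := hρ y hy p hp
      rw [pow_zero, mul_one]
      gcongr
    | succ n ih =>
      intro y hy
      have h1 : f (n + 1 + 1) y - f (n + 1) y = radialPrimitive (affineForm B a b (f (n + 1))) p y -
          radialPrimitive (affineForm B a b (f n)) p y := by
        simp [hf, flatIterate]
      rw [h1]
      have := norm_radialPrimitive_sub_le (hθC (n + 1)).continuous (hθC n).continuous hS
        (C := K * κ * (M * ρ * (1 / 4) ^ n)) (fun z hz => (norm_affineForm_sub_le hK hK0 hκ _ _ hz).trans
          (mul_le_mul_of_nonneg_left (ih z hz) hKκ)) hp hy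
      refine this.trans ?_
      calc _ ≤ K * κ * (M * ρ * (1 / 4) ^ n) * ρ := by gcongr; exact hρ y hy p hp
        _ = (K * κ * ρ) * (M * ρ * (1 / 4) ^ n) := by ring
        _ ≤ (1 / 4) * (M * ρ * (1 / 4) ^ n) := by gcongr; linarith
        _ = _ := by ring
  -- The defect of iterate `n + 1` is at most the homotopy error, `2 * K * κ * ρ` times the bound on
  -- the previous defect, plus the change of the right-hand side, `K * κ` times the increment. With
  -- `K * κ * ρ ≤ 1 / 8` the bound shrinks by `3 / 8 ≤ 1 / 2`.
  have hε : ∀ n, ∀ y ∈ S, ‖fderiv ℝ (f n) y - affineForm B a b (f n) y‖ ≤ M * (1 / 2) ^ n := by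
    intro n
    induction n with
    | zero =>
      intro y hy
      have : fderiv ℝ (f 0) y = 0 := by simp [hf, flatIterate]
      simpa [this] using hθ0 y hy
    | succ n ih =>
      intro y hy
      have h1 : fderiv ℝ (f (n + 1)) y = fderiv ℝ (radialPrimitive (affineForm B a b (f n)) p) y := by
        simp only [hf, flatIterate]
        exact fderiv_const_add c
      have h2 := norm_fderiv_radialPrimitive_sub_le (hθC n) hS
        (C := 2 * (K * κ) * (M * (1 / 2) ^ n)) (by positivity) (fun z hz u w =>
          h.norm_extDeriv_affineForm_le hJ hK hK0 hz (hκ z hz) (ha.differentiable one_ne_zero z)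
            (hb.differentiable one_ne_zero z) (hfd n z) (ih z hz) u w) hp hy
      have h3 := (norm_affineForm_sub_le (b := b) hK hK0 hκ (f (n + 1)) (f n) hy).trans
        (mul_le_mul_of_nonneg_left (hδ n y hy) hKκ)
      have h4 : (1 / 4 : ℝ) ^ n ≤ (1 / 2) ^ n := by gcongr; norm_num
      rw [h1]
      calc _ = ‖(fderiv ℝ (radialPrimitive (affineForm B a b (f n)) p) y - affineForm B a b (f n) y) -
              (affineForm B a b (f (n + 1)) y - affineForm B a b (f n) y)‖ := by congr 1; abel
        _ ≤ 2 * (K * κ) * (M * (1 / 2) ^ n) * ρ + K * κ * (M * ρ * (1 / 4) ^ n) := by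
            refine (norm_sub_le _ _).trans (add_le_add (h2.trans ?_) h3)
            gcongr; exact hρ y hy p hp
        _ = (K * κ * ρ) * (M * (2 * (1 / 2) ^ n + (1 / 4) ^ n)) := by ring
        _ ≤ (1 / 8) * (M * (2 * (1 / 2) ^ n + (1 / 2) ^ n)) := by gcongr
        _ ≤ _ := by
            have : 0 ≤ M * (1 / 2 : ℝ) ^ n := by positivity
            rw [pow_succ]; linarith
  have hlim : ∀ y, ∃ l, y ∈ S → Tendsto (fun n => f n y) atTop (𝓝 l) := by
    intro y
    by_cases hy : y ∈ S
    · have : CauchySeq fun n => f n y :=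
        cauchySeq_of_le_geometric (1 / 4) (M * ρ) (by norm_num) fun n => by
          rw [dist_comm, dist_eq_norm]; exact hδ n y hy
      obtain ⟨l, hl⟩ := cauchySeq_tendsto_of_complete this
      exact ⟨l, fun _ => hl⟩
    · exact ⟨0, fun h => absurd h hy⟩
  choose g hg using hlim
  have hgn : ∀ n, ∀ y ∈ S, ‖f n y - g y‖ ≤ M * ρ * (1 / 4) ^ n / (1 - 1 / 4) := by
    intro n y hy
    rw [← dist_eq_norm]
    exact dist_le_of_le_geometric_of_tendsto (1 / 4) (M * ρ) (by norm_num)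
      (fun n => by rw [dist_comm, dist_eq_norm]; exact hδ n y hy) (hg y hy) n
  refine ⟨g, ?_, fun y hy => ?_⟩
  · refine tendsto_nhds_unique (hg p hp) ?_
    simp only [hf, flatIterate_self]
    exact tendsto_const_nhds
  · refine hasFDerivAt_of_tendstoUniformlyOn (l := atTop) hSo (f := f) (f' := fun n => fderiv ℝ (f n))
      (g' := affineForm B a b g) ?_ (fun n z _ => (hfd n z).hasFDerivAt) hg hy
    rw [Metric.tendstoUniformlyOn_iff]
    intro ε hε0
    have hlim0 : Tendsto (fun n : ℕ => K * κ * (M * ρ * (1 / 4) ^ n / (1 - 1 / 4)) + M * (1 / 2) ^ n)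
        atTop (𝓝 0) := by
      have h1 := tendsto_pow_atTop_nhds_zero_of_lt_one (r := (1 / 4 : ℝ)) (by norm_num) (by norm_num)
      have h2 := tendsto_pow_atTop_nhds_zero_of_lt_one (r := (1 / 2 : ℝ)) (by norm_num) (by norm_num)
      have := (((h1.const_mul (M * ρ)).div_const (1 - 1 / 4)).const_mul (K * κ)).add (h2.const_mul M)
      simpa using this
    filter_upwards [hlim0.eventually_lt_const hε0] with n hn z hz
    rw [dist_comm, dist_eq_norm]
    refine lt_of_le_of_lt ?_ hn
    calc _ = ‖(affineForm B a b (f n) z - affineForm B a b g z) +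
            (fderiv ℝ (f n) z - affineForm B a b (f n) z)‖ := by congr 1; abel
      _ ≤ _ := (norm_add_le _ _).trans (add_le_add ((norm_affineForm_sub_le hK hK0 hκ _ _ hz).trans
          (mul_le_mul_of_nonneg_left (hgn n z hz) hKκ)) (hε n z hz))

/-- Solutions of `dF + [a, F] = b` on a convex set are determined by one value. -/
theorem eqOn_of_hasFDerivAt_affineForm {S : Set E} (hS : Convex ℝ S) (ha : ContinuousOn a S)
    {F G : E → V} (hF : ∀ y ∈ S, HasFDerivAt F (affineForm B a b F y) y)
    (hG : ∀ y ∈ S, HasFDerivAt G (affineForm B a b G y) y) {p : E} (hp : p ∈ S) (hpe : F p = G p) :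
    EqOn F G S := by
  intro y hy
  have hmem : ∀ t ∈ Icc (0 : ℝ) 1, p + t • (y - p) ∈ S := fun t ht =>
    hS.add_smul_sub_mem hp hy ht
  -- Along the segment from `p` to `y` the term `b` cancels, and the difference of two solutions
  -- satisfies a homogeneous linear ODE with zero initial value.
  have hd : ∀ t ∈ Icc (0 : ℝ) 1, HasDerivAt (fun t : ℝ => F (p + t • (y - p)) - G (p + t • (y - p)))
      (-(B (a (p + t • (y - p)) (y - p)) (F (p + t • (y - p)) - G (p + t • (y - p))))) t := by
    intro t ht
    have h1 : HasDerivAt (fun t : ℝ => p + t • (y - p)) (y - p) t := by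
      simpa using ((hasDerivAt_id t).smul_const (y - p)).const_add p
    have h2 := ((hF _ (hmem t ht)).comp_hasDerivAt t h1).sub
      ((hG _ (hmem t ht)).comp_hasDerivAt t h1)
    refine h2.congr_deriv ?_
    rw [affineForm_apply, affineForm_apply, map_sub (B _)]
    abel
  have hca : ContinuousOn (fun t : ℝ => a (p + t • (y - p))) (Icc 0 1) :=
    ha.comp (by fun_prop) hmem
  obtain ⟨C, hC⟩ := isCompact_Icc.exists_bound_of_continuousOn hca
  have := eq_zero_of_abs_deriv_le_mul_abs_self_of_eq_zero_right (a := (0 : ℝ)) (b := 1)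
    (K := ‖B‖ * (C * ‖y - p‖))
    (f := fun t : ℝ => F (p + t • (y - p)) - G (p + t • (y - p)))
    (fun t ht => (hd t ht).continuousAt.continuousWithinAt)
    (fun t ht => (hd t (Ico_subset_Icc_self ht)).hasDerivWithinAt) (by simp [hpe])
    (fun t ht => by
      rw [norm_neg]
      refine (ContinuousLinearMap.le_opNorm₂ _ _ _).trans ?_
      gcongr
      exact (ContinuousLinearMap.le_opNorm _ _).trans
        (mul_le_mul_of_nonneg_right (hC t (Ico_subset_Icc_self ht)) (norm_nonneg _))) 1 (by simp)
  simpa [sub_eq_zero] using this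

end FlatSystem

/-! ### Gluing local sections over a simply connected space -/

section Monodromy

open Set Filter Topology Function

/-- On a simply connected space, a family of local sections `x ↦ e i x c` with unique continuation,
exactly one through each point over its domain, glues to a global section through any given
point. -/
theorem exists_global_section_of_unique_continuation {X Y : Type*} [TopologicalSpace X]
    [SimplyConnectedSpace X] [LocallyPathConnectedSpace X] (U : X → Set X)
    (hU : ∀ i, IsOpen (U i)) (hmem : ∀ x, x ∈ U x) (e : X → X → Y → Y)
    (hbij : ∀ i, ∀ x ∈ U i, Bijective (e i x))
    (hloc : ∀ i j, ∀ x ∈ U i ∩ U j, ∀ c d, e i x c = e j x d → ∀ᶠ z in 𝓝 x, e i z c = e j z d)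
    (x₀ : X) (c₀ : Y) :
    ∃ F : X → Y, F x₀ = c₀ ∧ ∀ x, ∃ c, ∀ᶠ z in 𝓝 x, F z = e x z c := by
  have : Nonempty Y := ⟨c₀⟩
  -- The labels `c` of local sections carry the discrete topology, so that the bundle of labels is a
  -- covering.
  let : TopologicalSpace Y := ⊥
  have : DiscreteTopology Y := ⟨rfl⟩
  have hr : ∀ i, ∀ x ∈ U i, ∀ y, e i x (invFun (e i x) y) = y := fun i x hx y =>
    rightInverse_invFun (hbij i x hx).2 y
  let Z : FiberBundleCore X X Y :=
    { baseSet := U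
      isOpen_baseSet := hU
      indexAt := id
      mem_baseSet_at := hmem
      coordChange := fun i j x v => invFun (e j x) (e i x v)
      coordChange_self := fun i x hx v => leftInverse_invFun (hbij i x hx).1 v
      continuousOn_coordChange := by
        intro i j
        rintro ⟨x, c⟩ ⟨hx, -⟩
        -- Local sections that agree at `x` agree nearby, so the change of label is locally
        -- constant, hence continuous.
        have h1 := hloc i j x hx c (invFun (e j x) (e i x c)) (hr j x hx.2 _).symm
        have h2 : ∀ᶠ p : X × Y in 𝓝 (x, c), invFun (e j p.1) (e i p.1 p.2) =
            invFun (e j x) (e i x c) := by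
          rw [nhds_prod_eq, nhds_discrete Y, Filter.prod_pure, eventually_map]
          filter_upwards [h1, (hU j).mem_nhds hx.2] with z hz hzj
          rw [hz, leftInverse_invFun (hbij j z hzj).1]
        exact (continuousAt_const.congr (EventuallyEq.symm h2)).continuousWithinAt
      coordChange_comp := by
        intro i j k x hx v
        rw [hr j x hx.1.2] }
  have hcov : IsCoveringMap Z.proj := FiberBundle.isCoveringMap (F := Y) (E := Z.Fiber)
  let y₀ : Y := invFun (e x₀ x₀) c₀
  -- Simple connectedness enters here: the identity of `X` lifts to a section of the covering.
  obtain ⟨s, ⟨hs0, hs⟩, -⟩ := hcov.existsUnique_continuousMap_lifts (ContinuousMap.id X) x₀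
    (⟨x₀, y₀⟩ : Z.TotalSpace) rfl
  have hsx : ∀ x, (s x).1 = x := fun x => congr_fun hs x
  -- As `indexAt` is `id`, a point of the total space over `x` carries its label relative to the
  -- family indexed by `x` itself.
  refine ⟨fun x => e x x (s x).2, ?_, fun x => ?_⟩
  · show e x₀ x₀ (s x₀).2 = c₀
    rw [hs0]
    exact hr x₀ x₀ (hmem x₀) c₀
  · have hcont : ContinuousAt (fun z => (Z.localTriv x (s z)).2) x := by
      have h1 : ContinuousAt (Z.localTriv x) (s x) :=
        (Z.localTriv x).continuousOn.continuousAt ((Z.localTriv x).open_source.mem_nhds (by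
          rw [(Z.localTriv x).mem_source]
          show (s x).1 ∈ U x
          rw [hsx]; exact hmem x))
      exact continuousAt_snd.comp (ContinuousAt.comp (f := s) h1 s.continuous.continuousAt)
    have hc : ∀ᶠ z in 𝓝 x, (Z.localTriv x (s z)).2 = (Z.localTriv x (s x)).2 :=
      hcont.eventually_mem
      (s := {(Z.localTriv x (s x)).2}) (by rw [nhds_discrete]; exact rfl)
    refine ⟨(Z.localTriv x (s x)).2, ?_⟩
    filter_upwards [hc, (hU x).mem_nhds (hmem x)] with z hz hzx
    rw [← hz]
    show e z z (s z).2 = e x z (invFun (e x (s z).1) (e (s z).1 (s z).1 (s z).2))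
    have : ∀ w : Z.TotalSpace, w.1 = z →
        e z z w.2 = e x z (invFun (e x w.1) (e w.1 w.1 w.2)) := by
      rintro ⟨w, c⟩ rfl
      exact (hr x w hzx _).symm
    exact this (s z) (hsx z)

end Monodromy

/-! ### One-forms and their exterior derivative in charts -/

section ChartForm

open Set Filter Topology

variable {E : Type*} [NormedAddCommGroup E] [NormedSpace ℝ E]
  {M : Type*} [TopologicalSpace M] [ChartedSpace E M] [IsManifold 𝓘(ℝ, E) ∞ M]
  {V : Type*} [NormedAddCommGroup V] [NormedSpace ℝ V]

/-- The coordinate expression of a one-form in the preferred chart at `x₀`, as a map into linear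
maps. -/
def OneForm.chartForm (α : OneForm E M V) (x₀ : M) (y : E) : E →L[ℝ] V :=
  (α ((extChartAt 𝓘(ℝ, E) x₀).symm y)).comp
    (mfderiv 𝓘(ℝ, E) 𝓘(ℝ, E) (extChartAt 𝓘(ℝ, E) x₀).symm y)

theorem OneForm.inChart_eq (α : OneForm E M V) (x₀ : M) (y : E) :
    α.inChart x₀ y =
      ContinuousAlternatingMap.ofSubsingleton ℝ E V (0 : Fin 1) (α.chartForm x₀ y) := rfl

omit [IsManifold 𝓘(ℝ, E) ∞ M] in
theorem isOpen_extChartAt_target' (x₀ : M) : IsOpen (extChartAt 𝓘(ℝ, E) x₀).target :=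
  isOpen_extChartAt_target x₀

/-- Smoothness of sections is defined through trivializations of the Hom bundle. This identifies
their coordinates with `chartForm`, which thereby inherits smoothness. -/
theorem OneForm.inCoordinates_eq (L : ∀ x : M, TangentSpace 𝓘(ℝ, E) x →L[ℝ] V) {x₀ x : M}
    (hx : x ∈ (chartAt E x₀).source) :
    ContinuousLinearMap.inCoordinates E (TangentSpace 𝓘(ℝ, E)) V (Bundle.Trivial M V) x₀ x x₀ x
      (L x) = (L x).comp
        (mfderiv 𝓘(ℝ, E) 𝓘(ℝ, E) (extChartAt 𝓘(ℝ, E) x₀).symm (extChartAt 𝓘(ℝ, E) x₀ x)) := by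
  have h := TangentBundle.symmL_trivializationAt (I := 𝓘(ℝ, E)) hx
  rw [modelWithCornersSelf_coe, range_id, mfderivWithin_univ] at h
  ext v
  simp only [ContinuousLinearMap.inCoordinates, h]
  simp
  rfl

theorem SmoothCurveOn.contDiffOn_chartForm {β : ℝ → OneForm E M V} {s : Set ℝ}
    (hβ : SmoothCurveOn β s) (x₀ : M) :
    ContDiffOn ℝ ∞ (fun p : ℝ × E => (β p.1).chartForm x₀ p.2)
      (s ×ˢ (extChartAt 𝓘(ℝ, E) x₀).target) := by
  rw [← contMDiffOn_iff_contDiffOn, modelWithCornersSelf_prod, ← chartedSpaceSelf_prod]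
  have h1 : ContMDiffOn (𝓘(ℝ, ℝ).prod 𝓘(ℝ, E)) (𝓘(ℝ, ℝ).prod 𝓘(ℝ, E)) ∞
      (fun p : ℝ × E => (p.1, (extChartAt 𝓘(ℝ, E) x₀).symm p.2))
      (s ×ˢ (extChartAt 𝓘(ℝ, E) x₀).target) :=
    contMDiffOn_fst.prodMk ((contMDiffOn_extChartAt_symm x₀).comp contMDiffOn_snd
      fun p hp => hp.2)
  have h2 := hβ.comp h1 (fun p hp => ⟨hp.1, mem_univ _⟩)
  set e := trivializationAt (E →L[ℝ] V)
    (fun x : M => TangentSpace 𝓘(ℝ, E) x →L[ℝ] Bundle.Trivial M V x) x₀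
  have he : ContMDiffOn (𝓘(ℝ, E).prod 𝓘(ℝ, E →L[ℝ] V)) (𝓘(ℝ, E).prod 𝓘(ℝ, E →L[ℝ] V)) ∞ e
    e.source := e.contMDiffOn
  have h3 := contMDiff_snd.comp_contMDiffOn (he.comp h2 fun p hp => by
    rw [mem_preimage, e.mem_source]
    simp [e, hom_trivializationAt_baseSet]
    simpa using (extChartAt 𝓘(ℝ, E) x₀).map_target hp.2)
  refine h3.congr fun p hp => ?_
  have hx : (extChartAt 𝓘(ℝ, E) x₀).symm p.2 ∈ (chartAt E x₀).source := by
    simpa using (extChartAt 𝓘(ℝ, E) x₀).map_target hp.2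
  have := OneForm.inCoordinates_eq (fun x => β p.1 x) hx
  rw [(extChartAt 𝓘(ℝ, E) x₀).right_inv hp.2] at this
  exact this.symm

theorem OneForm.contDiffOn_chartForm (α : OneForm E M V) (x₀ : M) :
    ContDiffOn ℝ ∞ (α.chartForm x₀) (extChartAt 𝓘(ℝ, E) x₀).target := by
  have h : SmoothCurveOn (fun _ => α) univ := (α.contMDiff.comp contMDiff_snd).contMDiffOn
  exact (h.contDiffOn_chartForm x₀).comp (f := fun y : E => ((0 : ℝ), y))
    (contDiff_const.prodMk contDiff_id).contDiffOn (fun y hy => ⟨mem_univ _, hy⟩)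

theorem mfderiv_extChartAt_comp_symm {x₀ : M} {y : E} (hy : y ∈ (extChartAt 𝓘(ℝ, E) x₀).target) :
    (mfderiv 𝓘(ℝ, E) 𝓘(ℝ, E) (extChartAt 𝓘(ℝ, E) x₀) ((extChartAt 𝓘(ℝ, E) x₀).symm y)).comp
      (mfderiv 𝓘(ℝ, E) 𝓘(ℝ, E) (extChartAt 𝓘(ℝ, E) x₀).symm y) = ContinuousLinearMap.id ℝ E := by
  have := mfderiv_extChartAt_comp_mfderivWithin_extChartAt_symm (I := 𝓘(ℝ, E)) hy
  rw [modelWithCornersSelf_coe, range_id, mfderivWithin_univ] at this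
  exact this

theorem mfderiv_extChartAt_symm_comp {x₀ x : M} (hx : x ∈ (extChartAt 𝓘(ℝ, E) x₀).source) :
    (mfderiv 𝓘(ℝ, E) 𝓘(ℝ, E) (extChartAt 𝓘(ℝ, E) x₀).symm (extChartAt 𝓘(ℝ, E) x₀ x)).comp
      (mfderiv 𝓘(ℝ, E) 𝓘(ℝ, E) (extChartAt 𝓘(ℝ, E) x₀) x) = ContinuousLinearMap.id ℝ _ := by
  have := mfderivWithin_extChartAt_symm_comp_mfderiv_extChartAt' (I := 𝓘(ℝ, E)) hx
  rw [modelWithCornersSelf_coe, range_id, mfderivWithin_univ] at this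
  exact this

theorem mdifferentiableAt_extChartAt_symm' {x₀ : M} {y : E}
    (hy : y ∈ (extChartAt 𝓘(ℝ, E) x₀).target) :
    MDifferentiableAt 𝓘(ℝ, E) 𝓘(ℝ, E) (extChartAt 𝓘(ℝ, E) x₀).symm y := by
  have := mdifferentiableWithinAt_extChartAt_symm (I := 𝓘(ℝ, E)) hy
  rwa [modelWithCornersSelf_coe, range_id, mdifferentiableWithinAt_univ] at this

/-- A one-form is recovered from its coordinate expression. -/
theorem OneForm.chartForm_comp_mfderiv (α : OneForm E M V) {x₀ x : M}
    (hx : x ∈ (extChartAt 𝓘(ℝ, E) x₀).source) :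
    (α.chartForm x₀ (extChartAt 𝓘(ℝ, E) x₀ x)).comp
      (mfderiv 𝓘(ℝ, E) 𝓘(ℝ, E) (extChartAt 𝓘(ℝ, E) x₀) x) = α x := by
  have h := mfderiv_extChartAt_symm_comp hx
  -- The base point is generalized because `left_inv` is only a propositional equality while the
  -- tangent space depends on the point.
  have key : ∀ z, z = x → ∀ (L : E →L[ℝ] TangentSpace 𝓘(ℝ, E) z)
      (D : TangentSpace 𝓘(ℝ, E) x →L[ℝ] E), (∀ v, (L (D v) : E) = v) →
      ∀ v, (α z (L (D v)) : V) = α x v := by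
    rintro z rfl L D h v
    rw [h]
  ext v
  exact key _ ((extChartAt 𝓘(ℝ, E) x₀).left_inv hx) _ _ (fun v => DFunLike.congr_fun h v) v

/-- The transition map between two preferred charts. -/
theorem OneForm.chartForm_eventuallyEq (α : OneForm E M V) {x₀ x : M}
    (hx : x ∈ (extChartAt 𝓘(ℝ, E) x₀).source) :
    ∀ᶠ z in 𝓝 (extChartAt 𝓘(ℝ, E) x x), α.chartForm x z =
      (α.chartForm x₀ ((extChartAt 𝓘(ℝ, E) x₀ ∘ (extChartAt 𝓘(ℝ, E) x).symm) z)).comp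
        (fderiv ℝ (extChartAt 𝓘(ℝ, E) x₀ ∘ (extChartAt 𝓘(ℝ, E) x).symm) z) := by
  have h1 : ∀ᶠ z in 𝓝 (extChartAt 𝓘(ℝ, E) x x),
      (extChartAt 𝓘(ℝ, E) x).symm z ∈ (extChartAt 𝓘(ℝ, E) x₀).source := by
    refine (continuousAt_extChartAt_symm x).eventually_mem ?_
    rw [extChartAt_to_inv]
    exact (isOpen_extChartAt_source x₀).mem_nhds hx
  filter_upwards [h1, (isOpen_extChartAt_target' x).mem_nhds (mem_extChartAt_target x)] with z hz hzt
  rw [← mfderiv_eq_fderiv, mfderiv_comp z (mdifferentiableAt_extChartAt (by simpa using hz))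
    (mdifferentiableAt_extChartAt_symm' hzt)]
  have := α.chartForm_comp_mfderiv hz
  ext v
  exact (DFunLike.congr_fun this _).symm

theorem hasFDerivAt_ofSubsingleton {a : E → E →L[ℝ] V} {y : E} (ha : DifferentiableAt ℝ a y) :
    HasFDerivAt (fun y => ContinuousAlternatingMap.ofSubsingleton ℝ E V (0 : Fin 1) (a y))
      ((ContinuousAlternatingMap.ofSubsingletonLIE (𝕜 := ℝ) (E := E) (F := V)
        (0 : Fin 1)).toContinuousLinearEquiv.toContinuousLinearMap.comp (fderiv ℝ a y)) y :=
  (ContinuousAlternatingMap.ofSubsingletonLIE (𝕜 := ℝ) (E := E) (F := V)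
    (0 : Fin 1)).toContinuousLinearEquiv.toContinuousLinearMap.hasFDerivAt.comp y ha.hasFDerivAt

/-- This fixes the normalization of `d` on one-forms: no factor `1 / 2`. -/
theorem extDeriv_ofSubsingleton_apply {a : E → E →L[ℝ] V} {y : E} (ha : DifferentiableAt ℝ a y)
    (u w : E) :
    extDeriv (fun y => ContinuousAlternatingMap.ofSubsingleton ℝ E V (0 : Fin 1) (a y)) y ![u, w] =
      fderiv ℝ a y u w - fderiv ℝ a y w u := by
  rw [extDeriv, (hasFDerivAt_ofSubsingleton ha).fderiv,
    ContinuousAlternatingMap.alternatizeUncurryFin_apply]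
  simp [Fin.sum_univ_two, Fin.removeNth]
  abel

theorem compContinuousLinearMap_apply_pair (A : E [⋀^Fin 2]→L[ℝ] V) (D D' : E →L[ℝ] E) (v w : E) :
    (A.compContinuousLinearMap D).compContinuousLinearMap D' ![v, w] =
      A ![D (D' v), D (D' w)] := by
  simp only [ContinuousAlternatingMap.compContinuousLinearMap_apply]
  congr 1
  ext i
  fin_cases i <;> rfl

/-- The exterior derivative of a one-form, computed in any of the preferred charts. -/
theorem OneForm.extDeriv_apply_chart (α : OneForm E M V) {x₀ x : M}
    (hx : x ∈ (extChartAt 𝓘(ℝ, E) x₀).source) (v w : TangentSpace 𝓘(ℝ, E) x) :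
    α.extDeriv x ![v, w] =
      fderiv ℝ (α.chartForm x₀) (extChartAt 𝓘(ℝ, E) x₀ x)
        (mfderiv 𝓘(ℝ, E) 𝓘(ℝ, E) (extChartAt 𝓘(ℝ, E) x₀) x v)
        (mfderiv 𝓘(ℝ, E) 𝓘(ℝ, E) (extChartAt 𝓘(ℝ, E) x₀) x w) -
      fderiv ℝ (α.chartForm x₀) (extChartAt 𝓘(ℝ, E) x₀ x)
        (mfderiv 𝓘(ℝ, E) 𝓘(ℝ, E) (extChartAt 𝓘(ℝ, E) x₀) x w)
        (mfderiv 𝓘(ℝ, E) 𝓘(ℝ, E) (extChartAt 𝓘(ℝ, E) x₀) x v) := by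
  set ψ := extChartAt 𝓘(ℝ, E) x₀ ∘ (extChartAt 𝓘(ℝ, E) x).symm with hψ
  set y := extChartAt 𝓘(ℝ, E) x x with hy
  have hψy : ψ y = extChartAt 𝓘(ℝ, E) x₀ x := by simp [hψ, hy]
  have hψC : ContDiffAt ℝ ∞ ψ y := by
    rw [← contMDiffAt_iff_contDiffAt]
    refine ContMDiffAt.comp y (I' := 𝓘(ℝ, E)) ?_ ?_
    · rw [hy, extChartAt_to_inv]
      exact contMDiffAt_extChartAt' (by simpa using hx)
    · exact (contMDiffOn_extChartAt_symm x).contMDiffAt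
        ((isOpen_extChartAt_target' x).mem_nhds (mem_extChartAt_target x))
  have ha : DifferentiableAt ℝ (α.chartForm x₀) (ψ y) :=
    ((α.contDiffOn_chartForm x₀).contDiffAt ((isOpen_extChartAt_target' x₀).mem_nhds
      (by rw [hψy]; exact (extChartAt 𝓘(ℝ, E) x₀).map_source hx))).differentiableAt (by simp)
  -- The two coordinate expressions differ by pullback along the transition map `ψ`, with which the
  -- exterior derivative commutes.
  have h1 : α.inChart x =ᶠ[𝓝 y] fun z => (ContinuousAlternatingMap.ofSubsingleton ℝ E V (0 : Fin 1)
      (α.chartForm x₀ (ψ z))).compContinuousLinearMap (fderiv ℝ ψ z) := by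
    filter_upwards [α.chartForm_eventuallyEq hx] with z hz
    rw [OneForm.inChart_eq, hz]
    rfl
  have h2 := extDeriv_pullback (r := ∞) (hasFDerivAt_ofSubsingleton ha).differentiableAt hψC
    (by rw [minSmoothness_of_isRCLikeNormedField]; exact WithTop.coe_le_coe.2 le_top)
  have h3 := extDeriv_ofSubsingleton_apply ha
    (mfderiv 𝓘(ℝ, E) 𝓘(ℝ, E) (extChartAt 𝓘(ℝ, E) x₀) x v)
    (mfderiv 𝓘(ℝ, E) 𝓘(ℝ, E) (extChartAt 𝓘(ℝ, E) x₀) x w)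
  have h4 : mfderiv 𝓘(ℝ, E) 𝓘(ℝ, E) (extChartAt 𝓘(ℝ, E) x₀) x = fderiv ℝ ψ y := by
    have h := (mdifferentiableAt_extChartAt (I := 𝓘(ℝ, E)) (x := x₀) (y := x)
      (by simpa using hx)).mfderiv
    rw [modelWithCornersSelf_coe, range_id, fderivWithin_univ] at h
    exact h
  have h5 : mfderiv 𝓘(ℝ, E) 𝓘(ℝ, E) (extChartAt 𝓘(ℝ, E) x) x = ContinuousLinearMap.id ℝ _ :=
    mfderiv_extChartAt_self
  have h6 : α.extDeriv x = ((_root_.extDeriv (fun y => ContinuousAlternatingMap.ofSubsingleton ℝ E V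
      (0 : Fin 1) (α.chartForm x₀ y)) (ψ y)).compContinuousLinearMap
      (fderiv ℝ ψ y)).compContinuousLinearMap (ContinuousLinearMap.id ℝ E) := by
    rw [OneForm.extDeriv, h1.extDeriv_eq, h2, h5]
    rfl
  rw [h6]
  refine (compContinuousLinearMap_apply_pair (E := E) (V := V) _ _ _ v w).trans ?_
  rw [hψy] at h3 ⊢
  rw [← h4]
  exact h3

end ChartForm

/-! ### Local solvability and smoothness for systems on open sets -/

section FlatSystemLocal

open Set Filter Topology

variable {E : Type*} [NormedAddCommGroup E] [NormedSpace ℝ E]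
  {V : Type*} [NormedAddCommGroup V] [NormedSpace ℝ V]

/-- The derivative in a parameter commutes with the Fréchet derivative in space. -/
theorem hasDerivAt_fderiv_of_contDiffAt {g : ℝ → E → V} {c : E → V} {t : ℝ} {y : E}
    (hg : ContDiffAt ℝ 2 (Function.uncurry g) (t, y))
    (hc : ∀ᶠ z in 𝓝 y, HasDerivAt (fun s => g s z) (c z) t) :
    HasDerivAt (fun s => fderiv ℝ (g s) y) (fderiv ℝ c y) t := by
  set G := Function.uncurry g with hG
  have hd : ∀ᶠ p in 𝓝 (t, y), DifferentiableAt ℝ G p := by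
    filter_upwards [(hg.of_le (by norm_num : (1 : ℕ∞ω) ≤ 2)).eventually (by simp)] with p hp
    exact hp.differentiableAt one_ne_zero
  have hD : DifferentiableAt ℝ (fderiv ℝ G) (t, y) :=
    (hg.fderiv_right (m := 1) (by norm_num)).differentiableAt one_ne_zero
  -- The claim is the symmetry of the second derivative of `G` in the directions `(1, 0)` and `(0,
  -- w)`.
  have hsymm : IsSymmSndFDerivAt ℝ G (t, y) :=
    hg.isSymmSndFDerivAt (by rw [minSmoothness_of_isRCLikeNormedField])
  have h1 : ∀ᶠ s in 𝓝 t,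
      fderiv ℝ (g s) y = (fderiv ℝ G (s, y)).comp (ContinuousLinearMap.inr ℝ ℝ E) := by
    have : ContinuousAt (fun s : ℝ => (s, y)) t := by fun_prop
    filter_upwards [this.eventually hd] with s hs
    exact (HasFDerivAt.comp (f := fun z : E => (s, z)) y hs.hasFDerivAt
      (hasFDerivAt_prodMk_right s y)).fderiv
  have h2 : c =ᶠ[𝓝 y] fun z => fderiv ℝ G (t, z) (1, 0) := by
    have : ContinuousAt (fun z : E => (t, z)) y := by fun_prop
    filter_upwards [this.eventually hd, hc] with z hz hcz
    have h3 : HasDerivAt (fun s => g s z) (fderiv ℝ G (t, z) (1, 0)) t :=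
      HasFDerivAt.comp_hasDerivAt (f := fun s : ℝ => (s, z)) t hz.hasFDerivAt
        ((hasDerivAt_id t).prodMk (hasDerivAt_const t z))
    exact hcz.unique h3
  have h4 : HasDerivAt (fun s : ℝ => fderiv ℝ G (s, y)) (fderiv ℝ (fderiv ℝ G) (t, y) (1, 0)) t :=
    HasFDerivAt.comp_hasDerivAt (f := fun s : ℝ => (s, y)) t hD.hasFDerivAt
      ((hasDerivAt_id t).prodMk (hasDerivAt_const t y))
  have h5 : HasFDerivAt (fun z : E => fderiv ℝ G (t, z))
      ((fderiv ℝ (fderiv ℝ G) (t, y)).comp (ContinuousLinearMap.inr ℝ ℝ E)) y :=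
    HasFDerivAt.comp (f := fun z : E => (t, z)) y hD.hasFDerivAt (hasFDerivAt_prodMk_right t y)
  have h6 := (h5.clm_apply (hasFDerivAt_const ((1 : ℝ), (0 : E)) y)).congr_of_eventuallyEq h2
  have h7 := (h4.clm_comp (hasDerivAt_const t (ContinuousLinearMap.inr ℝ ℝ E))).congr_of_eventuallyEq
    h1
  refine h7.congr_deriv ?_
  rw [h6.fderiv]
  ext w
  simpa using hsymm (1, 0) (0, w)

/-- A smooth map on an open set agrees near any given point with a globally smooth map. -/
theorem ContDiffOn.exists_contDiff_eqOn_ball [FiniteDimensional ℝ E] {f : E → V} {U : Set E}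
    (hf : ContDiffOn ℝ ∞ f U) (hU : IsOpen U) {y₀ : E} (hy₀ : y₀ ∈ U) :
    ∃ r > 0, Metric.ball y₀ r ⊆ U ∧ ∃ g : E → V, ContDiff ℝ ∞ g ∧ EqOn g f (Metric.ball y₀ r) := by
  obtain ⟨R, hR, hRU⟩ := Metric.nhds_basis_closedBall.mem_iff.1 (hU.mem_nhds hy₀)
  let χ : ContDiffBump y₀ := ⟨R / 2, R, by positivity, by linarith⟩
  refine ⟨R / 2, by positivity,
    ((Metric.ball_subset_ball (by linarith)).trans Metric.ball_subset_closedBall).trans hRU,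
    fun y => χ y • f y, ?_, fun y hy => ?_⟩
  · rw [contDiff_iff_contDiffAt]
    intro y
    by_cases hy : y ∈ U
    · exact χ.contDiffAt.smul (hf.contDiffAt (hU.mem_nhds hy))
    · have hy' : y ∈ (Metric.closedBall y₀ R)ᶜ := fun h => hy (hRU h)
      have : (fun y => χ y • f y) =ᶠ[𝓝 y] fun _ => 0 := by
        filter_upwards [Metric.isClosed_closedBall.isOpen_compl.mem_nhds hy'] with z hz
        rw [χ.zero_of_le_dist (not_le.1 (mt Metric.mem_closedBall.2 hz)).le, zero_smul]
      exact contDiffAt_const.congr_of_eventuallyEq this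
  · have : χ y = 1 := χ.one_of_mem_closedBall (Metric.ball_subset_closedBall hy)
    simp [this]

variable {B : V →L[ℝ] V →L[ℝ] V} {a b : E → E →L[ℝ] V}

/-- A flat affine system is solvable near any point. -/
theorem IsFlatOn.exists_ball [FiniteDimensional ℝ E] [CompleteSpace V]
    (hJ : ∀ u v w, B u (B v w) - B v (B u w) = B (B u v) w) {U : Set E} (hU : IsOpen U)
    (h : IsFlatOn B a b U) (ha : ContDiffOn ℝ ∞ a U) (hb : ContDiffOn ℝ ∞ b U) {y₀ : E}
    (hy₀ : y₀ ∈ U) :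
    ∃ r > 0, Metric.ball y₀ r ⊆ U ∧ ∀ p ∈ Metric.ball y₀ r, ∀ c : V, ∃ F : E → V, F p = c ∧
      ∀ y ∈ Metric.ball y₀ r, HasFDerivAt F (affineForm B a b F y) y := by
  -- The iteration integrates globally `C¹` coefficients, so `a` and `b` are first replaced by
  -- global smooth maps agreeing with them near `y₀`.
  obtain ⟨r₁, hr₁, hr₁U, a', ha', haa'⟩ := ha.exists_contDiff_eqOn_ball hU hy₀
  obtain ⟨r₂, hr₂, -, b', hb', hbb'⟩ := hb.exists_contDiff_eqOn_ball hU hy₀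
  have hna : ∀ᶠ y in 𝓝 y₀, ‖a' y‖ < ‖a' y₀‖ + 1 :=
    ha'.continuous.norm.continuousAt.eventually_lt_const (by simp)
  have hnb : ∀ᶠ y in 𝓝 y₀, ‖b' y‖ < ‖b' y₀‖ + 1 :=
    hb'.continuous.norm.continuousAt.eventually_lt_const (by simp)
  obtain ⟨r₃, hr₃, hr₃'⟩ := Metric.eventually_nhds_iff_ball.1 (hna.and hnb)
  set κ := ‖a' y₀‖ + 1 with hκ
  have hκ0 : 0 < κ := by positivity
  set K := ‖B‖ + 1 with hK
  have hK0 : 0 < K := by positivity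
  -- The last term gives `K * κ * (2 * r) ≤ 1 / 8`, where `2 * r` bounds the diameter of the ball.
  set r := min (min r₁ r₂) (min r₃ (1 / (16 * (K * κ)))) with hr
  have hr0 : 0 < r := by positivity
  have hrr₁ : r ≤ r₁ := (min_le_left _ _).trans (min_le_left _ _)
  have hrr₂ : r ≤ r₂ := (min_le_left _ _).trans (min_le_right _ _)
  have hrr₃ : r ≤ r₃ := (min_le_right _ _).trans (min_le_left _ _)
  have hrr₄ : r ≤ 1 / (16 * (K * κ)) := (min_le_right _ _).trans (min_le_right _ _)
  have haa : EqOn a' a (Metric.ball y₀ r) := haa'.mono (Metric.ball_subset_ball hrr₁)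
  have hbb : EqOn b' b (Metric.ball y₀ r) := hbb'.mono (Metric.ball_subset_ball hrr₂)
  have hrU : Metric.ball y₀ r ⊆ U := (Metric.ball_subset_ball hrr₁).trans hr₁U
  have hflat : IsFlatOn B a' b' (Metric.ball y₀ r) := by
    constructor
    · intro y hy u w
      rw [(haa.eventuallyEq_of_mem (Metric.isOpen_ball.mem_nhds hy)).fderiv_eq, haa hy]
      exact h.curvature y (hrU hy) u w
    · intro y hy u w
      rw [(hbb.eventuallyEq_of_mem (Metric.isOpen_ball.mem_nhds hy)).fderiv_eq, haa hy, hbb hy]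
      exact h.closed y (hrU hy) u w
  refine ⟨r, hr0, hrU, fun p hp c => ?_⟩
  obtain ⟨F, hFp, hF⟩ := hflat.exists_hasFDerivAt hJ (ha'.of_le (by simp)) (hb'.of_le (by simp))
    (convex_ball _ _) Metric.isOpen_ball (K := K) (κ := κ) (β := ‖b' y₀‖ + 1) (ρ := 2 * r)
    (fun u v => (B.le_opNorm₂ u v).trans (by gcongr; simp [hK])) hK0.le
    (fun y hy => (hr₃' y (Metric.ball_subset_ball hrr₃ hy)).1.le)
    (fun y hy => (hr₃' y (Metric.ball_subset_ball hrr₃ hy)).2.le)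
    (fun y hy z hz => by
      rw [← dist_eq_norm]
      rw [Metric.mem_ball] at hy hz
      linarith [dist_triangle_right y z y₀])
    (by
      rw [le_div_iff₀ (by positivity)] at hrr₄
      linarith) hp c
  refine ⟨F, hFp, fun y hy => ?_⟩
  have : affineForm B a b F y = affineForm B a' b' F y := by
    simp only [affineForm, haa hy, hbb hy]
  rw [this]
  exact hF y hy

/-- Solutions of `dF + [a, F] = b` are smooth. -/
theorem contDiffOn_of_hasFDerivAt_affineForm {U : Set E} (hU : IsOpen U)
    (ha : ContDiffOn ℝ ∞ a U) (hb : ContDiffOn ℝ ∞ b U) {F : E → V}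
    (hF : ∀ y ∈ U, HasFDerivAt F (affineForm B a b F y) y) : ContDiffOn ℝ ∞ F U := by
  rw [contDiffOn_infty]
  intro n
  induction n with
  | zero =>
    exact contDiffOn_zero.2 fun y hy => (hF y hy).continuousAt.continuousWithinAt
  | succ n ih =>
    rw [Nat.cast_succ, contDiffOn_succ_iff_fderiv_of_isOpen hU]
    refine ⟨fun y hy => (hF y hy).differentiableAt.differentiableWithinAt, by simp, ?_⟩
    -- Bootstrapping: the derivative of `F` is as regular as `F`, because the system expresses it
    -- through `F`.
    have h1 : ContDiffOn ℝ n (affineForm B a b F) U :=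
      (contDiffOn_infty.1 hb n).sub
        ((B.flip.contDiff.comp_contDiffOn ih).clm_comp (contDiffOn_infty.1 ha n))
    exact h1.congr fun y hy => (hF y hy).fderiv

end FlatSystemLocal

/-! ### Covariant primitives on a simply connected manifold -/

section CovariantPrimitive

open Set Filter Topology

variable {E : Type*} [NormedAddCommGroup E] [NormedSpace ℝ E]
  {M : Type*} [TopologicalSpace M] [ChartedSpace E M] [IsManifold 𝓘(ℝ, E) ∞ M]
  {V : Type*} [NormedAddCommGroup V] [NormedSpace ℝ V]
  {B : V →L[ℝ] V →L[ℝ] V} {α η : OneForm E M V}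

/-- `F` satisfies `dF + [α, F] = η` at the point `x`. -/
def HasCovariantDerivAt (B : V →L[ℝ] V →L[ℝ] V) (α η : OneForm E M V) (F : M → V) (x : M) : Prop :=
  HasMFDerivAt 𝓘(ℝ, E) 𝓘(ℝ, V) F x (η x - (B.flip (F x)).comp (α x) : E →L[ℝ] V)

theorem HasCovariantDerivAt.hasFDerivAt_chart {F : M → V} {x₀ : M} {y : E}
    (hy : y ∈ (extChartAt 𝓘(ℝ, E) x₀).target)
    (h : HasCovariantDerivAt B α η F ((extChartAt 𝓘(ℝ, E) x₀).symm y)) :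
    HasFDerivAt (F ∘ (extChartAt 𝓘(ℝ, E) x₀).symm)
      (affineForm B (α.chartForm x₀) (η.chartForm x₀) (F ∘ (extChartAt 𝓘(ℝ, E) x₀).symm) y) y := by
  have h1 := HasMFDerivAt.comp y h (mdifferentiableAt_extChartAt_symm' hy).hasMFDerivAt
  rw [hasMFDerivAt_iff_hasFDerivAt] at h1
  exact h1

theorem hasCovariantDerivAt_comp_chart {f : E → V} {x₀ x : M}
    (hx : x ∈ (extChartAt 𝓘(ℝ, E) x₀).source)
    (h : HasFDerivAt f (affineForm B (α.chartForm x₀) (η.chartForm x₀) f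
      (extChartAt 𝓘(ℝ, E) x₀ x)) (extChartAt 𝓘(ℝ, E) x₀ x)) :
    HasCovariantDerivAt B α η (f ∘ extChartAt 𝓘(ℝ, E) x₀) x := by
  have h1 := HasMFDerivAt.comp x h.hasMFDerivAt
    (mdifferentiableAt_extChartAt (by simpa using hx)).hasMFDerivAt
  have hα := α.chartForm_comp_mfderiv hx
  have hη := η.chartForm_comp_mfderiv hx
  have h2 : (η x - (B.flip ((f ∘ extChartAt 𝓘(ℝ, E) x₀) x)).comp (α x) : E →L[ℝ] V) =
      (affineForm B (α.chartForm x₀) (η.chartForm x₀) f (extChartAt 𝓘(ℝ, E) x₀ x)).comp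
      (mfderiv 𝓘(ℝ, E) 𝓘(ℝ, E) (extChartAt 𝓘(ℝ, E) x₀) x) := by
    rw [← hα, ← hη]
    rfl
  rw [HasCovariantDerivAt, h2]
  exact h1

theorem HasCovariantDerivAt.congr_of_eventuallyEq {F G : M → V} {x : M}
    (h : HasCovariantDerivAt B α η G x) (hFG : F =ᶠ[𝓝 x] G) : HasCovariantDerivAt B α η F x := by
  rw [HasCovariantDerivAt, hFG.eq_of_nhds]
  exact HasMFDerivAt.congr_of_eventuallyEq h hFG

/-- Local uniqueness for `dF + [α, F] = η`. -/
theorem HasCovariantDerivAt.eventuallyEq {F G : M → V} {x : M}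
    (hF : ∀ᶠ z in 𝓝 x, HasCovariantDerivAt B α η F z)
    (hG : ∀ᶠ z in 𝓝 x, HasCovariantDerivAt B α η G z) (h : F x = G x) : F =ᶠ[𝓝 x] G := by
  set φ := extChartAt 𝓘(ℝ, E) x with hφ
  have hsymm : Tendsto φ.symm (𝓝 (φ x)) (𝓝 x) := by
    have := continuousAt_extChartAt_symm (I := 𝓘(ℝ, E)) x
    rwa [ContinuousAt, extChartAt_to_inv] at this
  have h1 : ∀ᶠ y in 𝓝 (φ x), y ∈ φ.target ∧ HasCovariantDerivAt B α η F (φ.symm y) ∧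
      HasCovariantDerivAt B α η G (φ.symm y) :=
    ((isOpen_extChartAt_target' x).eventually_mem (mem_extChartAt_target x)).and
      (hsymm.eventually (hF.and hG))
  obtain ⟨r, hr, hball⟩ := Metric.eventually_nhds_iff_ball.1 h1
  have heq := eqOn_of_hasFDerivAt_affineForm (B := B) (convex_ball (φ x) r)
    ((α.contDiffOn_chartForm x).continuousOn.mono fun y hy => (hball y hy).1)
    (b := η.chartForm x) (F := F ∘ φ.symm) (G := G ∘ φ.symm)
    (fun y hy => (hball y hy).2.1.hasFDerivAt_chart (hball y hy).1)
    (fun y hy => (hball y hy).2.2.hasFDerivAt_chart (hball y hy).1)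
    (Metric.mem_ball_self hr) (by simpa [hφ] using h)
  filter_upwards [(continuousAt_extChartAt (I := 𝓘(ℝ, E)) x).preimage_mem_nhds
    (Metric.ball_mem_nhds _ hr), extChartAt_source_mem_nhds (I := 𝓘(ℝ, E)) x] with z hz hzs
  have := heq hz
  simp only [Function.comp_apply] at this
  rwa [φ.left_inv hzs] at this

/-- Solutions of `dF + [α, F] = η` are smooth. -/
theorem contMDiff_of_hasCovariantDerivAt {F : M → V} (h : ∀ x, HasCovariantDerivAt B α η F x) :
    ContMDiff 𝓘(ℝ, E) 𝓘(ℝ, V) ∞ F := by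
  intro x
  have h1 := contDiffOn_of_hasFDerivAt_affineForm (isOpen_extChartAt_target' x)
    (α.contDiffOn_chartForm x) (η.contDiffOn_chartForm x)
    fun y hy => (h _).hasFDerivAt_chart (B := B) hy
  have h2 : ContMDiffAt 𝓘(ℝ, E) 𝓘(ℝ, V) ∞ (F ∘ (extChartAt 𝓘(ℝ, E) x).symm)
      (extChartAt 𝓘(ℝ, E) x x) :=
    (h1.contDiffAt ((isOpen_extChartAt_target' x).mem_nhds (mem_extChartAt_target x))).contMDiffAt
  refine (h2.comp x contMDiffAt_extChartAt).congr_of_eventuallyEq ?_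
  filter_upwards [extChartAt_source_mem_nhds (I := 𝓘(ℝ, E)) x] with z hz
  simp only [Function.comp_apply]
  rw [(extChartAt 𝓘(ℝ, E) x).left_inv hz]

/-- On a simply connected manifold, a one-form `η` that is closed for the covariant derivative of
the flat connection `α` is the covariant derivative of a function. -/
theorem exists_hasCovariantDerivAt [FiniteDimensional ℝ E] [SimplyConnectedSpace M]
    [CompleteSpace V] (hJ : ∀ u v w, B u (B v w) - B v (B u w) = B (B u v) w)
    (hflat : ∀ x₀ : M, IsFlatOn B (α.chartForm x₀) (η.chartForm x₀)
      (extChartAt 𝓘(ℝ, E) x₀).target) :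
    ∃ F : M → V, ∀ x, HasCovariantDerivAt B α η F x := by
  have hloc : ∀ x₀ : M, ∃ r > 0, Metric.ball (extChartAt 𝓘(ℝ, E) x₀ x₀) r ⊆
      (extChartAt 𝓘(ℝ, E) x₀).target ∧ ∀ p ∈ Metric.ball (extChartAt 𝓘(ℝ, E) x₀ x₀) r, ∀ c : V,
      ∃ F : E → V, F p = c ∧ ∀ y ∈ Metric.ball (extChartAt 𝓘(ℝ, E) x₀ x₀) r,
        HasFDerivAt F (affineForm B (α.chartForm x₀) (η.chartForm x₀) F y) y := fun x₀ =>
    (hflat x₀).exists_ball hJ (isOpen_extChartAt_target' x₀) (α.contDiffOn_chartForm x₀)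
      (η.contDiffOn_chartForm x₀) (mem_extChartAt_target x₀)
  choose r hr hrt hsol using hloc
  -- The local solutions around `x₀` are labelled by their value `c` at the centre of the chart
  -- ball.
  choose f hf hfd using fun x₀ c => hsol x₀ _ (Metric.mem_ball_self (hr x₀)) c
  have : LocallyPathConnectedSpace M := ChartedSpace.locallyPathConnectedSpace E M
  set U : M → Set M := fun x₀ => (extChartAt 𝓘(ℝ, E) x₀).source ∩
    extChartAt 𝓘(ℝ, E) x₀ ⁻¹' Metric.ball (extChartAt 𝓘(ℝ, E) x₀ x₀) (r x₀) with hU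
  have hUo : ∀ x, IsOpen (U x) := fun x =>
    (continuousOn_extChartAt x).isOpen_inter_preimage (isOpen_extChartAt_source x) Metric.isOpen_ball
  have hUm : ∀ x, x ∈ U x := fun x => ⟨mem_extChartAt_source x, Metric.mem_ball_self (hr x)⟩
  have huniq : ∀ x₀ (F G : E → V), (∀ y ∈ Metric.ball (extChartAt 𝓘(ℝ, E) x₀ x₀) (r x₀),
      HasFDerivAt F (affineForm B (α.chartForm x₀) (η.chartForm x₀) F y) y) →
      (∀ y ∈ Metric.ball (extChartAt 𝓘(ℝ, E) x₀ x₀) (r x₀),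
      HasFDerivAt G (affineForm B (α.chartForm x₀) (η.chartForm x₀) G y) y) →
      ∀ p ∈ Metric.ball (extChartAt 𝓘(ℝ, E) x₀ x₀) (r x₀), F p = G p →
      EqOn F G (Metric.ball (extChartAt 𝓘(ℝ, E) x₀ x₀) (r x₀)) := fun x₀ F G hF hG p hp h =>
    eqOn_of_hasFDerivAt_affineForm (convex_ball _ _)
      ((α.contDiffOn_chartForm x₀).continuousOn.mono (hrt x₀)) hF hG hp h
  have hcov : ∀ x₀ c, ∀ x ∈ U x₀,
      HasCovariantDerivAt B α η (f x₀ c ∘ extChartAt 𝓘(ℝ, E) x₀) x := fun x₀ c x hx =>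
    hasCovariantDerivAt_comp_chart hx.1 (hfd x₀ c _ hx.2)
  obtain ⟨x₀⟩ : Nonempty M := inferInstance
  obtain ⟨F, -, hF⟩ := exists_global_section_of_unique_continuation U hUo hUm
    (fun x₀ x c => f x₀ c (extChartAt 𝓘(ℝ, E) x₀ x))
    -- Injectivity is uniqueness of solutions on the ball; surjectivity is solvability with any
    -- value prescribed at any point of the ball, not only at its centre.
    (fun i x hx => ⟨fun c d hcd => by
      have := huniq i _ _ (hfd i c) (hfd i d) _ hx.2 hcd (Metric.mem_ball_self (hr i))
      rwa [hf, hf] at this, fun v => by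
      obtain ⟨G, hG, hGd⟩ := hsol i _ hx.2 v
      refine ⟨G (extChartAt 𝓘(ℝ, E) i i), ?_⟩
      have := huniq i _ _ (hfd i (G (extChartAt 𝓘(ℝ, E) i i))) hGd _ (Metric.mem_ball_self (hr i))
        (hf _ _) hx.2
      exact this.trans hG⟩)
    (fun i j x hx c d hcd => HasCovariantDerivAt.eventuallyEq
      (by filter_upwards [(hUo i).mem_nhds hx.1] with z hz using hcov i c z hz)
      (by filter_upwards [(hUo j).mem_nhds hx.2] with z hz using hcov j d z hz) hcd) x₀ (0 : V)
  refine ⟨F, fun x => ?_⟩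
  obtain ⟨c, hc⟩ := hF x
  exact (hcov x c x (hUm x)).congr_of_eventuallyEq hc

end CovariantPrimitive

/-! ### Lie algebra identities and the curvature in charts -/

section LieAlgebraIdentities

variable {EG : Type*} [NormedAddCommGroup EG] [NormedSpace ℝ EG] [FiniteDimensional ℝ EG]
  {G : Type*} [TopologicalSpace G] [ChartedSpace EG G] [Group G] [LieGroup 𝓘(ℝ, EG) ∞ G]

theorem LieAlg.bracketL_skew (u v : LieAlg EG G) :
    LieAlg.bracketL EG G u v = -LieAlg.bracketL EG G v u := by
  have := LieAlg.lieGroup_minSmoothness EG G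
  have : CompleteSpace EG := FiniteDimensional.complete ℝ EG
  exact (lie_skew (L := GroupLieAlgebra 𝓘(ℝ, EG) G) u v).symm

theorem LieAlg.bracketL_jacobi (u v w : LieAlg EG G) :
    LieAlg.bracketL EG G u (LieAlg.bracketL EG G v w) -
      LieAlg.bracketL EG G v (LieAlg.bracketL EG G u w) =
      LieAlg.bracketL EG G (LieAlg.bracketL EG G u v) w := by
  have := LieAlg.lieGroup_minSmoothness EG G
  have : CompleteSpace EG := FiniteDimensional.complete ℝ EG
  rw [sub_eq_iff_eq_add]
  exact leibniz_lie (L₁ := GroupLieAlgebra 𝓘(ℝ, EG) G) (L₂ := GroupLieAlgebra 𝓘(ℝ, EG) G)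
    (M := GroupLieAlgebra 𝓘(ℝ, EG) G) u v w

variable {E : Type*} [NormedAddCommGroup E] [NormedSpace ℝ E]
  {M : Type*} [TopologicalSpace M] [ChartedSpace E M] [IsManifold 𝓘(ℝ, E) ∞ M]

/-- By skew-symmetry the two terms of `[α, α]` coincide, which absorbs the factor `1 / 2`. -/
theorem half_smul_bracket_self (α : OneForm E M (LieAlg EG G)) (x : M)
    (v w : TangentSpace 𝓘(ℝ, E) x) :
    (1 / 2 : ℝ) • α.bracket α x v w = LieAlg.bracketL EG G (α x v) (α x w) := by
  have h : α.bracket α x v w = LieAlg.bracketL EG G (α x v) (α x w) -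
    LieAlg.bracketL EG G (α x w) (α x v) := rfl
  rw [h, LieAlg.bracketL_skew (α x w : LieAlg EG G) (α x v : LieAlg EG G)]
  module

/-- The curvature `da + ½[a, a]` of the coordinate expression of a one-form. -/
def OneForm.chartCurvature (α : OneForm E M (LieAlg EG G)) (x₀ : M) (y u w : E) : LieAlg EG G :=
  fderiv ℝ (α.chartForm x₀) y u w - fderiv ℝ (α.chartForm x₀) y w u +
    LieAlg.bracketL EG G (α.chartForm x₀ y u) (α.chartForm x₀ y w)

theorem chartCurvature_eq_zero {α : OneForm E M (LieAlg EG G)}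
    (hα : α ∈ maurerCartanForms E M EG G) {x₀ : M} {y : E}
    (hy : y ∈ (extChartAt 𝓘(ℝ, E) x₀).target) (u w : E) : α.chartCurvature x₀ y u w = 0 := by
  have hx := (extChartAt 𝓘(ℝ, E) x₀).map_target hy
  have h := hα ((extChartAt 𝓘(ℝ, E) x₀).symm y)
    (mfderiv 𝓘(ℝ, E) 𝓘(ℝ, E) (extChartAt 𝓘(ℝ, E) x₀).symm y u)
    (mfderiv 𝓘(ℝ, E) 𝓘(ℝ, E) (extChartAt 𝓘(ℝ, E) x₀).symm y w)
  rw [half_smul_bracket_self, α.extDeriv_apply_chart hx] at h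
  have hid := fun u => DFunLike.congr_fun (mfderiv_extChartAt_comp_symm hy) u
  simp only [ContinuousLinearMap.comp_apply] at hid
  rw [(extChartAt 𝓘(ℝ, E) x₀).right_inv hy] at h
  erw [hid, hid] at h
  exact h

theorem mem_maurerCartanForms_of_chartCurvature {α : OneForm E M (LieAlg EG G)}
    (h : ∀ (x₀ : M), ∀ u w : E, α.chartCurvature x₀ (extChartAt 𝓘(ℝ, E) x₀ x₀) u w = 0) :
    α ∈ maurerCartanForms E M EG G := by
  intro x v w
  have hx := mem_extChartAt_source (I := 𝓘(ℝ, E)) x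
  rw [half_smul_bracket_self, α.extDeriv_apply_chart hx]
  have h1 := h x (mfderiv 𝓘(ℝ, E) 𝓘(ℝ, E) (extChartAt 𝓘(ℝ, E) x) x v)
    (mfderiv 𝓘(ℝ, E) 𝓘(ℝ, E) (extChartAt 𝓘(ℝ, E) x) x w)
  have h2 := fun v => DFunLike.congr_fun (α.chartForm_comp_mfderiv hx) v
  rw [← h2 v, ← h2 w]
  exact h1

end LieAlgebraIdentities

/-! ### The linear gauge flow on the Lie algebra -/

section GaugeFlow

variable {V : Type*} [NormedAddCommGroup V] [NormedSpace ℝ V] (B : V →L[ℝ] V →L[ℝ] V)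

/-- The endomorphism `(a, b) ↦ (b - [X, a], 0)` of `V × V`. -/
def gaugeGenerator (X : V) : V × V →L[ℝ] V × V :=
  (ContinuousLinearMap.inl ℝ V V).comp
    (ContinuousLinearMap.snd ℝ V V - (B X).comp (ContinuousLinearMap.fst ℝ V V))

/-- The solution `(a, b) ↦ exp (-t ad X) a + (∫₀ᵗ exp (-s ad X) ds) b` of the linear equation
`u' = b - [X, u]`, `u 0 = a`. -/
def gaugeFlow (t : ℝ) (X : V) : V × V →L[ℝ] V :=
  (ContinuousLinearMap.fst ℝ V V).comp (NormedSpace.exp (t • gaugeGenerator B X))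

theorem gaugeFlow_zero (X : V) : gaugeFlow B 0 X = ContinuousLinearMap.fst ℝ V V := by
  rw [gaugeFlow, zero_smul, NormedSpace.exp_zero]
  rfl

variable [CompleteSpace V]

/-- The generator has image in `V × 0`, so the flow conserves the second component, which acts as a
constant forcing term on the first. -/
theorem snd_comp_exp_gaugeGenerator (X : V) (t : ℝ) :
    (ContinuousLinearMap.snd ℝ V V).comp (NormedSpace.exp (t • gaugeGenerator B X)) =
      ContinuousLinearMap.snd ℝ V V := by
  have hd : ∀ t : ℝ, HasDerivAt (fun t : ℝ => (ContinuousLinearMap.snd ℝ V V).comp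
      (NormedSpace.exp (t • gaugeGenerator B X))) 0 t := fun t => by
    refine ((hasDerivAt_const t (ContinuousLinearMap.snd ℝ V V)).clm_comp
      (hasDerivAt_exp_smul_const' (𝕂 := ℝ) (gaugeGenerator B X) t)).congr_deriv ?_
    ext p <;> simp [gaugeGenerator, ContinuousLinearMap.mul_def]
  have := is_const_of_deriv_eq_zero (fun t => (hd t).differentiableAt) (fun t => (hd t).deriv) t 0
  rw [this, zero_smul, NormedSpace.exp_zero]
  rfl

theorem hasDerivAt_gaugeFlow (X : V) (t : ℝ) :
    HasDerivAt (fun t => gaugeFlow B t X)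
      (ContinuousLinearMap.snd ℝ V V - (B X).comp (gaugeFlow B t X)) t := by
  refine ((hasDerivAt_const t (ContinuousLinearMap.fst ℝ V V)).clm_comp
    (hasDerivAt_exp_smul_const' (𝕂 := ℝ) (gaugeGenerator B X) t)).congr_deriv ?_
  have h := snd_comp_exp_gaugeGenerator B X t
  rw [← h]
  ext p <;> simp [gaugeGenerator, gaugeFlow, ContinuousLinearMap.mul_def]

/-- Adjoining the forcing term as a second component makes the integral a block of an exponential;
joint smoothness in `(t, X)` then follows from analyticity of `exp`. -/
theorem contDiff_gaugeFlow : ContDiff ℝ ∞ fun p : ℝ × V => gaugeFlow B p.1 p.2 := by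
  have h1 : ContDiff ℝ ∞ fun p : ℝ × V => p.1 • gaugeGenerator B p.2 := by
    refine contDiff_fst.smul ?_
    exact contDiff_const.clm_comp
      (contDiff_const.sub ((B.contDiff.comp contDiff_snd).clm_comp contDiff_const))
  have h2 : ContDiff ℝ ∞ (NormedSpace.exp : (V × V →L[ℝ] V × V) → V × V →L[ℝ] V × V) :=
    contDiff_iff_contDiffAt.2 fun x => (NormedSpace.exp_analytic (𝕂 := ℝ) x).contDiffAt
  exact contDiff_const.clm_comp (h2.comp h1)

end GaugeFlow

/-! ### The gauge curve of one-forms -/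

section GaugeCurve

open Set Filter Topology

variable {E : Type*} [NormedAddCommGroup E] [NormedSpace ℝ E]
  {M : Type*} [TopologicalSpace M] [ChartedSpace E M] [IsManifold 𝓘(ℝ, E) ∞ M]
  {V : Type*} [NormedAddCommGroup V] [NormedSpace ℝ V]

/-- With this, `d(dF) = 0` becomes the symmetry of a second derivative in the chart. -/
theorem extDerivZero_chartForm (F : C^∞⟮𝓘(ℝ, E), M; 𝓘(ℝ, V), V⟯) {x₀ : M} {y : E}
    (hy : y ∈ (extChartAt 𝓘(ℝ, E) x₀).target) :
    (extDerivZero F).chartForm x₀ y = fderiv ℝ (F ∘ (extChartAt 𝓘(ℝ, E) x₀).symm) y := by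
  have hF : HasMFDerivAt 𝓘(ℝ, E) 𝓘(ℝ, V) F ((extChartAt 𝓘(ℝ, E) x₀).symm y)
      (extDerivZero F ((extChartAt 𝓘(ℝ, E) x₀).symm y) : E →L[ℝ] V) :=
    ((F.contMDiff _).mdifferentiableAt (by simp)).hasMFDerivAt
  have h : HasMFDerivAt 𝓘(ℝ, E) 𝓘(ℝ, V) (F ∘ (extChartAt 𝓘(ℝ, E) x₀).symm) y
      ((extDerivZero F).chartForm x₀ y : E →L[ℝ] V) :=
    HasMFDerivAt.comp y hF (mdifferentiableAt_extChartAt_symm' hy).hasMFDerivAt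
  have h' : HasFDerivAt (F ∘ (extChartAt 𝓘(ℝ, E) x₀).symm) ((extDerivZero F).chartForm x₀ y) y :=
    hasMFDerivAt_iff_hasFDerivAt.1 h
  exact h'.fderiv.symm

theorem contDiffOn_comp_extChartAt_symm (F : C^∞⟮𝓘(ℝ, E), M; 𝓘(ℝ, V), V⟯) (x₀ : M) :
    ContDiffOn ℝ ∞ (F ∘ (extChartAt 𝓘(ℝ, E) x₀).symm) (extChartAt 𝓘(ℝ, E) x₀).target :=
  contMDiffOn_iff_contDiffOn.1 (F.contMDiff.comp_contMDiffOn (contMDiffOn_extChartAt_symm x₀))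

variable [CompleteSpace V]

theorem contMDiff_gaugeFlow_comp (B : V →L[ℝ] V →L[ℝ] V) (α η : OneForm E M V)
    (F : C^∞⟮𝓘(ℝ, E), M; 𝓘(ℝ, V), V⟯) :
    ContMDiff (𝓘(ℝ, ℝ).prod 𝓘(ℝ, E)) (𝓘(ℝ, E).prod 𝓘(ℝ, E →L[ℝ] V)) ∞
      (fun p : ℝ × M => Bundle.TotalSpace.mk' (E →L[ℝ] V)
        (E := fun x : M => TangentSpace 𝓘(ℝ, E) x →L[ℝ] Bundle.Trivial M V x) p.2
        ((gaugeFlow B p.1 (F p.2)).comp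
          (ContinuousLinearMap.prod (α p.2 : E →L[ℝ] V) (η p.2 : E →L[ℝ] V)))) := by
  intro p₀
  have hsnd : ContMDiffAt (𝓘(ℝ, ℝ).prod 𝓘(ℝ, E)) 𝓘(ℝ, E) ∞ (Prod.snd : ℝ × M → M) p₀ :=
    contMDiffAt_snd
  have hα := ((contMDiffAt_hom_bundle _).1 (α.contMDiff p₀.2)).2.comp p₀ hsnd
  have hη := ((contMDiffAt_hom_bundle _).1 (η.contMDiff p₀.2)).2.comp p₀ hsnd
  rw [contMDiffAt_hom_bundle]
  refine ⟨contMDiffAt_snd, ?_⟩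
  have hflow : ContMDiffAt (𝓘(ℝ, ℝ).prod 𝓘(ℝ, E)) 𝓘(ℝ, V × V →L[ℝ] V) ∞
      (fun p : ℝ × M => gaugeFlow B p.1 (F p.2)) p₀ := by
    have h1 : ContMDiffAt (𝓘(ℝ, ℝ).prod 𝓘(ℝ, E)) 𝓘(ℝ, ℝ × V) ∞
        (fun p : ℝ × M => (p.1, F p.2)) p₀ :=
      contMDiffAt_fst.prodMk_space ((F.contMDiff _).comp p₀ contMDiffAt_snd)
    exact (contDiff_gaugeFlow B).contMDiff.contMDiffAt.comp p₀ h1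
  have hinl : ContMDiffAt (𝓘(ℝ, ℝ).prod 𝓘(ℝ, E)) 𝓘(ℝ, V →L[ℝ] V × V) ∞
      (fun _ : ℝ × M => ContinuousLinearMap.inl ℝ V V) p₀ := contMDiffAt_const
  have hinr : ContMDiffAt (𝓘(ℝ, ℝ).prod 𝓘(ℝ, E)) 𝓘(ℝ, V →L[ℝ] V × V) ∞
      (fun _ : ℝ × M => ContinuousLinearMap.inr ℝ V V) p₀ := contMDiffAt_const
  -- The flow is split into its action on `α` and on `η`, each a composition of maps smooth in
  -- coordinates.
  refine (((hflow.clm_comp hinl).clm_comp hα).add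
    ((hflow.clm_comp hinr).clm_comp hη)).congr_of_eventuallyEq (.of_forall fun p => ?_)
  ext v
  simp [ContinuousLinearMap.inCoordinates, ← map_add]

/-- The one-form `exp (-t ad F) ∘ α + (∫₀ᵗ exp (-s ad F) ds) ∘ η`. -/
def gaugeCurve (B : V →L[ℝ] V →L[ℝ] V) (α η : OneForm E M V)
    (F : C^∞⟮𝓘(ℝ, E), M; 𝓘(ℝ, V), V⟯) (t : ℝ) : OneForm E M V where
  toFun x := (gaugeFlow B t (F x)).comp
    (ContinuousLinearMap.prod (α x : E →L[ℝ] V) (η x : E →L[ℝ] V))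
  contMDiff_toFun := (contMDiff_gaugeFlow_comp B α η F).comp
    (contMDiff_const.prodMk contMDiff_id : ContMDiff 𝓘(ℝ, E) (𝓘(ℝ, ℝ).prod 𝓘(ℝ, E)) ∞
      fun x : M => (t, x))

theorem smoothCurveOn_gaugeCurve (B : V →L[ℝ] V →L[ℝ] V) (α η : OneForm E M V)
    (F : C^∞⟮𝓘(ℝ, E), M; 𝓘(ℝ, V), V⟯) (s : Set ℝ) : SmoothCurveOn (gaugeCurve B α η F) s :=
  (contMDiff_gaugeFlow_comp B α η F).contMDiffOn

theorem gaugeCurve_zero (B : V →L[ℝ] V →L[ℝ] V) (α η : OneForm E M V)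
    (F : C^∞⟮𝓘(ℝ, E), M; 𝓘(ℝ, V), V⟯) : gaugeCurve B α η F 0 = α := by
  ext x v
  show gaugeFlow B 0 (F x) _ = _
  rw [gaugeFlow_zero]
  rfl

theorem hasDerivAt_gaugeCurve_apply (B : V →L[ℝ] V →L[ℝ] V) (α η : OneForm E M V)
    (F : C^∞⟮𝓘(ℝ, E), M; 𝓘(ℝ, V), V⟯) (t : ℝ) (x : M) (v : TangentSpace 𝓘(ℝ, E) x) :
    HasDerivAt (fun s => (gaugeCurve B α η F s x v : V))
      ((η x v : V) - B (F x) (gaugeCurve B α η F t x v)) t := by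
  have h := (hasDerivAt_gaugeFlow B (F x) t).clm_apply (hasDerivAt_const t ((α x v : V), (η x v : V)))
  refine h.congr_deriv ?_
  simp
  rfl

theorem hasDerivAt_gaugeCurve_chartForm (B : V →L[ℝ] V →L[ℝ] V) (α η : OneForm E M V)
    (F : C^∞⟮𝓘(ℝ, E), M; 𝓘(ℝ, V), V⟯) (t : ℝ) (x₀ : M) (y : E) :
    HasDerivAt (fun s => (gaugeCurve B α η F s).chartForm x₀ y)
      (η.chartForm x₀ y - (B (F ((extChartAt 𝓘(ℝ, E) x₀).symm y))).comp
        ((gaugeCurve B α η F t).chartForm x₀ y)) t := by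
  have key : ∀ (X : V) (a b : E →L[ℝ] V) (D : E →L[ℝ] E),
      HasDerivAt (fun s => ((gaugeFlow B s X).comp (a.prod b)).comp D)
        (b.comp D - (B X).comp (((gaugeFlow B t X).comp (a.prod b)).comp D)) t := by
    intro X a b D
    refine (((hasDerivAt_gaugeFlow B X t).clm_comp (hasDerivAt_const t (a.prod b))).clm_comp
      (hasDerivAt_const t D)).congr_deriv ?_
    ext u
    simp
  exact key _ _ _ _

end GaugeCurve

/-! ### Linearized curvature and the two inclusions -/

section TangentSpace

open Set Filter Topology

variable {E : Type*} [NormedAddCommGroup E] [NormedSpace ℝ E]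
  {M : Type*} [TopologicalSpace M] [ChartedSpace E M] [IsManifold 𝓘(ℝ, E) ∞ M]
  {EG : Type*} [NormedAddCommGroup EG] [NormedSpace ℝ EG] [FiniteDimensional ℝ EG]
  {G : Type*} [TopologicalSpace G] [ChartedSpace EG G] [Group G] [LieGroup 𝓘(ℝ, EG) ∞ G]

/-- The derivative of the curvature along a smooth curve of one-forms. -/
theorem hasDerivAt_chartCurvature {β : ℝ → OneForm E M (LieAlg EG G)} {s : Set ℝ} (hs : IsOpen s)
    (hβ : SmoothCurveOn β s) {t : ℝ} (ht : t ∈ s) {x₀ : M} {y : E}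
    (hy : y ∈ (extChartAt 𝓘(ℝ, E) x₀).target) {c : E → E →L[ℝ] LieAlg EG G}
    (hc : ∀ᶠ z in 𝓝 y, HasDerivAt (fun s => (β s).chartForm x₀ z) (c z) t) (u w : E) :
    HasDerivAt (fun s => (β s).chartCurvature x₀ y u w)
      (fderiv ℝ c y u w - fderiv ℝ c y w u +
        (LieAlg.bracketL EG G (c y u) ((β t).chartForm x₀ y w) +
          LieAlg.bracketL EG G ((β t).chartForm x₀ y u) (c y w))) t := by
  have h1 : ContDiffAt ℝ 2 (Function.uncurry fun s z => (β s).chartForm x₀ z) (t, y) :=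
    ((hβ.contDiffOn_chartForm x₀).contDiffAt ((hs.prod (isOpen_extChartAt_target' x₀)).mem_nhds
      ⟨ht, hy⟩)).of_le (WithTop.coe_le_coe.2 le_top)
  have h2 := hasDerivAt_fderiv_of_contDiffAt h1 hc
  have h3 := fun u w => (h2.clm_apply (hasDerivAt_const t u)).clm_apply (hasDerivAt_const t w)
  have h4 := fun u => hc.self_of_nhds.clm_apply (hasDerivAt_const t u)
  have h5 := ((hasDerivAt_const t (LieAlg.bracketL EG G)).clm_apply (h4 u)).clm_apply (h4 w)
  refine (((h3 u w).sub (h3 w u)).add h5).congr_deriv ?_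
  simp

/-- Flatness is the vanishing of the curvature of `β 0`; closedness is the vanishing of its
derivative along `β`. -/
theorem isFlatOn_of_mem_tangentMaurerCartan {α η : OneForm E M (LieAlg EG G)}
    (hη : η ∈ tangentMaurerCartan α) (x₀ : M) :
    IsFlatOn (LieAlg.bracketL EG G) (α.chartForm x₀) (η.chartForm x₀)
      (extChartAt 𝓘(ℝ, E) x₀).target := by
  obtain ⟨ε, β, hε, hβ, rfl, hmem, hvel⟩ := hη
  have h0 : (0 : ℝ) ∈ Ioo (-ε) ε := ⟨by linarith, hε⟩
  refine ⟨fun y hy u w => chartCurvature_eq_zero (hmem 0 h0) hy u w, fun y hy u w => ?_⟩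
  have hc : ∀ᶠ z in 𝓝 y, HasDerivAt (fun s => (β s).chartForm x₀ z) (η.chartForm x₀ z) 0 := by
    filter_upwards [(isOpen_extChartAt_target' x₀).mem_nhds hy] with z hz
    -- `HasVelocityAt` speaks of one vector at a time; joint smoothness upgrades it to a derivative
    -- of linear maps.
    have hd : DifferentiableAt ℝ (fun s => (β s).chartForm x₀ z) 0 := by
      have hm : ((0 : ℝ), z) ∈ Ioo (-ε) ε ×ˢ (extChartAt 𝓘(ℝ, E) x₀).target := ⟨h0, hz⟩
      have h1 := ((hβ.contDiffOn_chartForm x₀).contDiffAt ((isOpen_Ioo.prod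
        (isOpen_extChartAt_target' x₀)).mem_nhds hm)).differentiableAt (by simp)
      exact h1.comp (f := fun s : ℝ => (s, z)) 0 (by fun_prop)
    have : deriv (fun s => (β s).chartForm x₀ z) 0 = η.chartForm x₀ z := by
      ext u
      have h1 := hd.hasDerivAt.clm_apply (hasDerivAt_const 0 u)
      rw [map_zero, add_zero] at h1
      exact h1.unique (hvel _ _)
    rw [← this]
    exact hd.hasDerivAt
  have h1 := hasDerivAt_chartCurvature isOpen_Ioo hβ h0 hy hc u w
  have h2 : HasDerivAt (fun s => (β s).chartCurvature x₀ y u w) 0 0 := by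
    refine (hasDerivAt_const (0 : ℝ) (0 : LieAlg EG G)).congr_of_eventuallyEq ?_
    filter_upwards [isOpen_Ioo.mem_nhds h0] with s hs
    exact chartCurvature_eq_zero (hmem s hs) hy u w
  rw [← h1.unique h2, LieAlg.bracketL_skew (η.chartForm x₀ y u)]
  abel

/-- Here `X`, `d`, `D` stand for `F`, `dF` and its second derivative, and `a`, `a'` for the form and
its derivative. By symmetry of `D` and the Jacobi identity, the curvature varies by its bracket with
`F` in the direction `dF - [F, a]`. -/
theorem linearized_curvature_gauge {B : LieAlg EG G →L[ℝ] LieAlg EG G →L[ℝ] LieAlg EG G}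
    (hB : B = LieAlg.bracketL EG G) {D : E →L[ℝ] E →L[ℝ] LieAlg EG G} {u w : E}
    (hD : D u w = D w u) (X : LieAlg EG G) (d a : E →L[ℝ] LieAlg EG G)
    (a' : E →L[ℝ] E →L[ℝ] LieAlg EG G) :
    D u w - (B X (a' u w) + B (d u) (a w)) - (D w u - (B X (a' w u) + B (d w) (a u))) +
      (B (d u - B X (a u)) (a w) + B (a u) (d w - B X (a w))) =
      B (a' u w - a' w u + B (a u) (a w)) X := by
  subst hB
  have hJ := LieAlg.bracketL_jacobi X (a u) (a w)
  have h1 := LieAlg.bracketL_skew (a' u w - a' w u + LieAlg.bracketL EG G (a u) (a w)) X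
  have h2 := LieAlg.bracketL_skew (d w) (a u)
  rw [h1, hD]
  simp only [map_add, map_sub, sub_apply]
  rw [h2, ← hJ]
  abel

theorem gaugeCurve_mem_maurerCartanForms {α : OneForm E M (LieAlg EG G)}
    (hα : α ∈ maurerCartanForms E M EG G)
    (F : C^∞⟮𝓘(ℝ, E), M; 𝓘(ℝ, LieAlg EG G), LieAlg EG G⟯) [CompleteSpace (LieAlg EG G)] (t : ℝ) :
    gaugeCurve (LieAlg.bracketL EG G) α (extDerivZero F) F t ∈ maurerCartanForms E M EG G := by
  refine mem_maurerCartanForms_of_chartCurvature fun x₀ u w => ?_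
  set B := LieAlg.bracketL EG G with hB
  set y := extChartAt 𝓘(ℝ, E) x₀ x₀ with hy
  have hyt : y ∈ (extChartAt 𝓘(ℝ, E) x₀).target := mem_extChartAt_target x₀
  set f := F ∘ (extChartAt 𝓘(ℝ, E) x₀).symm with hf
  set β := gaugeCurve B α (extDerivZero F) F with hβ
  set g := fun s => (β s).chartForm x₀ with hg
  have hfC : ContDiffAt ℝ ∞ f y := (contDiffOn_comp_extChartAt_symm F x₀).contDiffAt
    ((isOpen_extChartAt_target' x₀).mem_nhds hyt)
  have hgd : ∀ s, DifferentiableAt ℝ (g s) y := fun s =>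
    (((β s).contDiffOn_chartForm x₀).contDiffAt
      ((isOpen_extChartAt_target' x₀).mem_nhds hyt)).differentiableAt (by simp)
  have hderiv : ∀ s, HasDerivAt (fun s => (β s).chartCurvature x₀ y u w)
      (B ((β s).chartCurvature x₀ y u w) (f y)) s := by
    intro s
    have h1 := hasDerivAt_chartCurvature isOpen_univ (smoothCurveOn_gaugeCurve B α (extDerivZero F)
      F univ) (mem_univ s) hyt
      (.of_forall fun z => hasDerivAt_gaugeCurve_chartForm B α (extDerivZero F) F s x₀ z) u w
    have hc : (fun z => (extDerivZero F).chartForm x₀ z -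
        (B (F ((extChartAt 𝓘(ℝ, E) x₀).symm z))).comp (g s z)) =ᶠ[𝓝 y]
        fun z => fderiv ℝ f z - (B (f z)).comp (g s z) := by
      filter_upwards [(isOpen_extChartAt_target' x₀).mem_nhds hyt] with z hz
      rw [extDerivZero_chartForm F hz]
      rfl
    have hfd : DifferentiableAt ℝ (fderiv ℝ f) y :=
      (hfC.fderiv_right (m := 1) (WithTop.coe_le_coe.2 le_top)).differentiableAt one_ne_zero
    have hd := hfd.hasFDerivAt.sub (((B.hasFDerivAt (x := f y)).comp y
      (hfC.differentiableAt (by simp)).hasFDerivAt).clm_comp (hgd s).hasFDerivAt)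
    have hsymm : fderiv ℝ (fderiv ℝ f) y u w = fderiv ℝ (fderiv ℝ f) y w u :=
      hfC.isSymmSndFDerivAt (by
        rw [minSmoothness_of_isRCLikeNormedField]; exact WithTop.coe_le_coe.2 le_top) u w
    refine h1.congr_deriv ?_
    have hcf := hc.fderiv_eq.trans hd.fderiv
    have hcy := hc.eq_of_nhds
    rw [hcf, hcy, show (β s).chartCurvature x₀ y u w = fderiv ℝ (g s) y u w - fderiv ℝ (g s) y w u +
      B (g s y u) (g s y w) from rfl]
    exact linearized_curvature_gauge hB hsymm _ _ _ _
  have h0 : (β 0).chartCurvature x₀ y u w = 0 := by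
    rw [hβ, gaugeCurve_zero]
    exact chartCurvature_eq_zero hα hyt u w
  -- The curvature and the zero curve solve the same linear ODE `κ' = [κ, F]` with the same initial
  -- value.
  have hode := ODE_solution_unique_univ (v := fun _ X => B X (f y)) (s := fun _ => univ)
    (K := ‖B.flip (f y)‖₊) (t₀ := 0) (g := fun _ => (0 : LieAlg EG G))
    (fun _ => ((B.flip (f y)).lipschitz).lipschitzOnWith) (fun s => ⟨hderiv s, mem_univ _⟩)
    (fun s => ⟨by simpa using hasDerivAt_const s (0 : LieAlg EG G), mem_univ _⟩) h0
  exact congr_fun hode t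

end TangentSpace

end

theorem lemma3p1
    {E : Type*} [NormedAddCommGroup E] [NormedSpace ℝ E] [FiniteDimensional ℝ E]
    {M : Type*} [TopologicalSpace M] [T2Space M] [SecondCountableTopology M]
    [ChartedSpace E M] [IsManifold 𝓘(ℝ, E) ∞ M] [SimplyConnectedSpace M]
    {EG : Type*} [NormedAddCommGroup EG] [NormedSpace ℝ EG] [FiniteDimensional ℝ EG]
    {G : Type*} [TopologicalSpace G] [ChartedSpace EG G] [Group G] [LieGroup 𝓘(ℝ, EG) ∞ G]
    (α : OneForm E M (LieAlg EG G)) (hα : α ∈ maurerCartanForms E M EG G) :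
    tangentMaurerCartan α =
      {η | ∃ F : C^∞⟮𝓘(ℝ, E), M; 𝓘(ℝ, LieAlg EG G), LieAlg EG G⟯,
        η = extDerivZero F + α.bracketZero F} := by
  have : CompleteSpace (LieAlg EG G) := FiniteDimensional.complete ℝ _
  ext η
  constructor
  · intro hη
    obtain ⟨F, hF⟩ := exists_hasCovariantDerivAt (LieAlg.bracketL_jacobi (EG := EG) (G := G))
      (isFlatOn_of_mem_tangentMaurerCartan hη)
    refine ⟨⟨F, contMDiff_of_hasCovariantDerivAt hF⟩, ?_⟩
    ext x v
    have h : (mfderiv 𝓘(ℝ, E) 𝓘(ℝ, LieAlg EG G) F x v : LieAlg EG G) =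
        (η x v : LieAlg EG G) - LieAlg.bracketL EG G (α x v) (F x) := by
      rw [(hF x).mfderiv]
      rfl
    exact (sub_eq_iff_eq_add.1 h.symm)
  · rintro ⟨F, rfl⟩
    -- The gauge curve exists for all times, so any positive `ε` would do.
    refine ⟨1, gaugeCurve (LieAlg.bracketL EG G) α (extDerivZero F) F, one_pos,
      smoothCurveOn_gaugeCurve _ _ _ _ _, gaugeCurve_zero _ _ _ _,
      fun t _ => gaugeCurve_mem_maurerCartanForms hα F t, fun x v => ?_⟩
    refine (hasDerivAt_gaugeCurve_apply _ _ _ _ 0 x v).congr_deriv ?_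
    rw [gaugeCurve_zero, LieAlg.bracketL_skew, sub_neg_eq_add]
    rfl
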